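/- Let $0\le k\le n$, let $B$ and $B_-$ be the subgroups of upper and lower triangular matrices in $\mathrm{GL}_n(\mathbb C)$, let $P_{k,n}$ be the subgroup of invertible block matrices $\left(\begin{smallmatrix} a & b\\ 0 & d\end{smallmatrix}\right)$ with $a$ of size $k\times k$ and $d$ of size $(n-k)\times(n-k)$, put $\mathrm{Gr}(k,n)=\mathrm{GL}_n(\mathbb C)/P_{k,n}$, and let $q:\mathrm{GL}_n(\mathbb C)/B\to \mathrm{Gr}(k,n)$ be the projection. Identify $w\in S_n$ with the permutation matrix $e_j\mapsto e_{w(j)}$. The Lusztig strata of $\mathrm{Gr}(k,n)$ are the sets $$R_{v,w}=q\,(B_-\cdot vB\,\cap\, B\cdot wB),$$ where $v\in S_n$ has maximal length in its coset $v(S_k\times S_{n-k})$, $w\in S_n$, and $v\le w$ in the Bruhat order. Let $\chi$ be the infinitesimal action of $\mathfrak{gl}_n(\mathbb C)$ on $\mathrm{Gr}(k,n)$ given by $(\chi(X)f)(x)=\frac{d}{dt}\big|_{t=0}f(\exp(tX)x)$, and let $$\pi_{k,n}=-\sum_{1\le i<j\le n}\chi(E_{ij})\wedge\chi(E_{ji})$$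 be the standard Poisson structure on $\mathrm{Gr}(k,n)$. Let $c$ be the permutation matrix of the cycle $(1\,2\,\dots\,n)$. **Theorem (Knutson–Lam–Speyer; Yakimov).** 1. The action of $c$ on $\mathrm{Gr}(k,n)$ permutes the Lusztig strata: $R\mapsto cR$ is a bijection from the set of Lusztig strata onto itself. 2. Each Lusztig stratum $R$ with the restriction $\pi_{k,n}|_R$ is a regular Poisson variety: the Poisson bracket $\{F,G\}(x)$ at a point $x\in R$ of functions $F,G$ on $\mathrm{Gr}(k,n)$ holomorphic near $x$ depends only on the restrictions of $F$ and $G$ to $R$ near $x$, and the rank of the resulting Poisson structure $\pi_{k,n}|_R$ is constant on $R$. 3. If $R_1,R_2$ are Lusztig strata with $cR_1=R_2$, then $c$ restricts to an isomorphism of Poisson varieties $(R_1,\pi_{k,n}|_{R_1})\to(R_2,\pi_{k,n}|_{R_2})$, that is, to a biholomorphic homeomorphism which matches the Poisson brackets. Here a function on a stratum is holomorphic if it is locally the restriction of a holomorphic function on $\mathrm{Gr}(k,n)$. -/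

import Mathlib

open Topology

/-! ## The groups `B`, `B₋`, `P_{k,n}` in `GL_n(ℂ)`, and the Grassmannian -/

namespace LusztigGr

/-- The subgroup of `GL_n(ℂ)` of all matrices that are block triangular with respect to `b`:
the `(i, j)` entry vanishes whenever `b j < b i`. -/
def blockTriangularSubgroup (n : ℕ) {α : Type*} [LinearOrder α] (b : Fin n → α) :
    Subgroup (GL (Fin n) ℂ) where
  carrier := {g | Matrix.BlockTriangular (g : Matrix (Fin n) (Fin n) ℂ) b}
  one_mem' := Matrix.blockTriangular_one
  mul_mem' := fun {_ _} hx hy => Matrix.BlockTriangular.mul hx hy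
  inv_mem' := by
    intro x hx
    let := x.invertible
    have h := Matrix.blockTriangular_inv_of_blockTriangular
      (M := (x : Matrix (Fin n) (Fin n) ℂ)) (b := b) hx
    show Matrix.BlockTriangular ((x⁻¹ : GL (Fin n) ℂ) : Matrix (Fin n) (Fin n) ℂ) b
    rw [Matrix.coe_units_inv]
    exact h

/-- `B`: invertible upper triangular matrices. -/
def borel (n : ℕ) : Subgroup (GL (Fin n) ℂ) :=
  blockTriangularSubgroup n (fun i : Fin n => i)

/-- `B₋`: invertible lower triangular matrices. -/
def borelOpp (n : ℕ) : Subgroup (GL (Fin n) ℂ) :=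
  blockTriangularSubgroup n (fun i : Fin n => OrderDual.toDual i)

/-- `P_{k,n}`: invertible block matrices `(a b; 0 c)` with `a` of size `k × k` and `c` of size
`(n-k) × (n-k)`. -/
def parabolic (k n : ℕ) : Subgroup (GL (Fin n) ℂ) :=
  blockTriangularSubgroup n (fun i : Fin n => if (i : ℕ) < k then (0 : ℕ) else 1)

theorem borel_le_parabolic (k n : ℕ) : borel n ≤ parabolic k n := by
  intro g hg i j hij
  refine hg ?_
  show j < i
  rw [Fin.lt_def]
  by_cases hi : (i : ℕ) < k <;> by_cases hj : (j : ℕ) < k <;> simp [hi, hj] at hij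
  omega

/-- The Grassmannian `Gr(k,n) = GL_n(ℂ) / P_{k,n}`; the coset of `g` corresponds to the
`k`-dimensional subspace of `ℂⁿ` spanned by the first `k` columns of `g`. It carries the quotient
topology and the left action of `GL_n(ℂ)`. -/
abbrev Gr (k n : ℕ) : Type := GL (Fin n) ℂ ⧸ parabolic k n

/-- The projection `q : GL_n(ℂ)/B → GL_n(ℂ)/P_{k,n}`. -/
def q (k n : ℕ) : GL (Fin n) ℂ ⧸ borel n → Gr k n :=
  Subgroup.quotientMapOfLE (borel_le_parabolic k n)

/-- The permutation matrix of `w`, sending `e_j` to `e_{w j}`. -/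
noncomputable def permGL (n : ℕ) : Equiv.Perm (Fin n) →* GL (Fin n) ℂ :=
  (Matrix.permMatrixHom (n := Fin n) (R := ℂ)).toHomUnits

theorem permGL_apply (n : ℕ) (w : Equiv.Perm (Fin n)) (i j : Fin n) :
    (permGL n w : Matrix (Fin n) (Fin n) ℂ) i j = if i = w j then 1 else 0 := by
  change (Equiv.Perm.permMatrix ℂ w⁻¹) i j = _
  have h : (i = w j) ↔ (w⁻¹ i = j) := by
    rw [Equiv.Perm.inv_eq_iff_eq]
  simp [PEquiv.toMatrix_apply, Equiv.toPEquiv_apply, h, eq_comm]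

/-- The permutation matrix of the Coxeter element `c = (1 2 … n)`, i.e. of the cycle
`i ↦ i + 1` (mod `n`). -/
noncomputable def coxeter (n : ℕ) : GL (Fin n) ℂ := permGL n (finRotate n)

/-! ## Combinatorics of the symmetric group -/

/-- The length of a permutation: its number of inversions. -/
def length {n : ℕ} (w : Equiv.Perm (Fin n)) : ℕ :=
  (Finset.univ.filter fun p : Fin n × Fin n => p.1 < p.2 ∧ w p.2 < w p.1).card

/-- The Bruhat order: generated by `u < u t` for `t` a transposition with `ℓ(u) < ℓ(u t)`. -/
def BruhatLE {n : ℕ} : Equiv.Perm (Fin n) → Equiv.Perm (Fin n) → Prop :=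
  Relation.ReflTransGen fun u u' =>
    ∃ i j : Fin n, i ≠ j ∧ u' = u * Equiv.swap i j ∧ length u < length u'

/-- `v` has maximal length in its coset `v (S_k × S_{n-k})`. -/
def IsMaxRep (k : ℕ) {n : ℕ} (v : Equiv.Perm (Fin n)) : Prop :=
  ∀ u : Equiv.Perm (Fin n), (∀ i : Fin n, (u i : ℕ) < k ↔ (i : ℕ) < k) → length (v * u) ≤ length v

/-! ## The Lusztig strata -/

/-- `R_{v,w} = q (B₋ · vB ∩ B · wB)`, where `B₋ · vB` and `B · wB` are orbits in `GL_n(ℂ)/B`. -/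
def lusztigStratum (k n : ℕ) (v w : Equiv.Perm (Fin n)) : Set (Gr k n) :=
  q k n '' (MulAction.orbit (borelOpp n) (permGL n v : GL (Fin n) ℂ ⧸ borel n) ∩
    MulAction.orbit (borel n) (permGL n w : GL (Fin n) ℂ ⧸ borel n))

/-- The set of strata `R_{v,w}` with `v` of maximal length in `v (S_k × S_{n-k})`, `w ∈ S_n` and
`v ≤ w`. -/
def lusztigStrata (k n : ℕ) : Set (Set (Gr k n)) :=
  {S | ∃ v w : Equiv.Perm (Fin n), IsMaxRep k v ∧ BruhatLE v w ∧ S = lusztigStratum k n v w}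

/-! ## Holomorphic functions and the standard Poisson structure on `Gr(k,n)` -/

open Classical in
/-- The pullback of a function on `Gr(k,n)` to `GL_n(ℂ)`, regarded as a function of the matrix
entries (with value `0` at singular matrices, which plays no role). -/
noncomputable def pullback {k n : ℕ} (f : Gr k n → ℂ) (A : Fin n → Fin n → ℂ) : ℂ :=
  if h : IsUnit (Matrix.of A) then f ((h.unit : GL (Fin n) ℂ) : Gr k n) else 0

/-- `f` is holomorphic near `x` for the complex structure of the homogeneous space
`GL_n(ℂ)/P_{k,n}`: on the preimage in `GL_n(ℂ)` of some open neighbourhood of `x`, the pullback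
of `f` is a complex differentiable function of the matrix entries. -/
def HolAt {k n : ℕ} (f : Gr k n → ℂ) (x : Gr k n) : Prop :=
  ∃ U : Set (Gr k n), IsOpen U ∧ x ∈ U ∧ ∀ g : GL (Fin n) ℂ, (g : Gr k n) ∈ U →
    DifferentiableAt ℂ (pullback f) (fun i j => (g : Matrix (Fin n) (Fin n) ℂ) i j)

/-- The matrix exponential, as a map to `GL_n(ℂ)`. -/
noncomputable def expGL {n : ℕ} (X : Matrix (Fin n) (Fin n) ℂ) : GL (Fin n) ℂ :=
  (Matrix.isUnit_exp X).unit

/-- The infinitesimal action `χ : gl_n(ℂ) → Vect(Gr(k,n))`: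
`(χ(X) f)(x) = d/dt f(exp(tX) x)` at `t = 0`. -/
noncomputable def chi {k n : ℕ} (X : Matrix (Fin n) (Fin n) ℂ) (f : Gr k n → ℂ) (x : Gr k n) : ℂ :=
  deriv (fun t : ℂ => f (expGL (t • X) • x)) 0

/-- The Poisson bracket of `π_{k,n} = - ∑_{i<j} χ(E_ij) ∧ χ(E_ji)`. -/
noncomputable def bracket {k n : ℕ} (f g : Gr k n → ℂ) (x : Gr k n) : ℂ :=
  - ∑ i : Fin n, ∑ j ∈ Finset.Ioi i,
    (chi (Matrix.single i j 1) f x * chi (Matrix.single j i 1) g x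
      - chi (Matrix.single i j 1) g x * chi (Matrix.single j i 1) f x)

/-! ## Restriction of the Poisson structure to a subset of `Gr(k,n)` -/

/-- `F` is holomorphic on `Gr(k,n)` near `x` and extends `φ : R → ℂ` near `x`. -/
def IsExtensionAt {k n : ℕ} (R : Set (Gr k n)) (φ : R → ℂ) (x : R) (F : Gr k n → ℂ) : Prop :=
  HolAt F x ∧ ∀ᶠ y : R in 𝓝 x, F y = φ y

/-- `φ : R → ℂ` is holomorphic at `x ∈ R`: near `x` it is the restriction of a holomorphic function
on `Gr(k,n)`. -/
def HolOnAt {k n : ℕ} (R : Set (Gr k n)) (φ : R → ℂ) (x : R) : Prop :=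
  ∃ F, IsExtensionAt R φ x F

/-- The restriction of the Poisson structure to `R` is well defined: the bracket at `x ∈ R` depends
only on the restrictions of the functions to `R` near `x`. -/
def IsPoissonSubvariety {k n : ℕ} (R : Set (Gr k n)) : Prop :=
  ∀ (x : R) (φ ψ : R → ℂ) (F F' G G' : Gr k n → ℂ),
    IsExtensionAt R φ x F → IsExtensionAt R φ x F' →
    IsExtensionAt R ψ x G → IsExtensionAt R ψ x G' → bracket F G x = bracket F' G' x

open Classical in
/-- The Poisson bracket of `π_{k,n}|_R` at `x ∈ R`, for `φ`, `ψ` holomorphic at `x`: the bracket of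
local extensions to `Gr(k,n)`. It does not depend on them if `R` is a Poisson subvariety. -/
noncomputable def restrictedBracket {k n : ℕ} (R : Set (Gr k n)) (φ ψ : R → ℂ) (x : R) : ℂ :=
  if h : HolOnAt R φ x ∧ HolOnAt R ψ x then bracket h.1.choose h.2.choose x else 0

/-- The rank of `π_{k,n}|_R` at `x ∈ R`: the dimension of the space of all Hamiltonian
derivations `φ ↦ {φ, ψ}(x)` of the functions holomorphic at `x`. -/
noncomputable def restrictedRank {k n : ℕ} (R : Set (Gr k n)) (x : R) : ℕ :=
  Module.finrank ℂ (Submodule.span ℂ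
    {D : {φ : R → ℂ // HolOnAt R φ x} → ℂ |
      ∃ ψ : R → ℂ, HolOnAt R ψ x ∧ ∀ φ, D φ = restrictedBracket R φ ψ x})

/-- `(R, π_{k,n}|_R)` is a regular Poisson variety: the restriction is well defined and has
constant rank. -/
def IsRegularPoisson {k n : ℕ} (R : Set (Gr k n)) : Prop :=
  IsPoissonSubvariety R ∧ ∀ x y : R, restrictedRank R x = restrictedRank R y

/-- `e : R₁ → R₂` is an isomorphism from `(R₁, π_{k,n}|_{R₁})` to `(R₂, π_{k,n}|_{R₂})`: it is
biholomorphic and matches the Poisson brackets. -/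
def IsPoissonIso {k n : ℕ} {R₁ R₂ : Set (Gr k n)} (e : R₁ ≃ₜ R₂) : Prop :=
  (∀ (φ : R₂ → ℂ) (x : R₁), HolOnAt R₁ (φ ∘ e) x ↔ HolOnAt R₂ φ (e x)) ∧
  ∀ (φ ψ : R₂ → ℂ) (x : R₁), HolOnAt R₂ φ (e x) → HolOnAt R₂ ψ (e x) →
    restrictedBracket R₁ (φ ∘ e) (ψ ∘ e) x = restrictedBracket R₂ φ ψ (e x)

end LusztigGr

/-! Part 1. For a k-dimensional subspace V consider the dimensions of V ∩ ℂ^I for all cyclic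
intervals I of indices. The nonempty Lusztig strata are exactly the classes of points with equal
cyclic ranks, and c only shifts cyclic intervals. To see this, lift V to a flag F_• in B₋vB ∩ BwB.
Maximality makes v decreasing on each of the two blocks, so V ∩ ℂ^{≥b} and V + ℂ^{≥b} are steps of
F_•, of dimensions dictated by v; meeting them with ℂ^{<a} gives dimensions dictated by w. The
modular law handles the intervals that wrap around (`cyclicEq_of_inCell`). Conversely each F_j with
j ≥ 1 is such an intersection or sum, so the ranks recover v and w (`eq_of_cyclicEq`). The Bruhat
decomposition puts every point into a stratum, and the tableau criterion gives v ≤ w there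
(`exists_lift`).

Part 2. By the trace form, covectors at gP are matrices ζ in the nilradical of the parabolic. With η
= gζg⁻¹, the Hamiltonian vector of ζ is -2 times the direction `upHalf η`, because products of two
covectors have trace zero (`skewPairing_eq`). Factor 1 + tη = m(t)b(t), lower times upper triangular
with equal diagonals. Then b(t)g = m(t)⁻¹g(1 + tζ) lies in BwB by the first expression and in B₋vB
by the second, so Hamiltonian vectors are tangent to curves inside the stratum (`exists_curve`), and
the bracket restricts.

The rank is the dimension of the nilradical minus that of the radical, the space of covectors with
zero Hamiltonian vector; here every covector must be the gradient of a function
(`exists_gradient_eq`). Two points of a stratum have lifts g = hv and g' = h'v with g' = bgγ, where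
h, h' ∈ B₋ and b, γ ∈ B; this yields an injection between their radicals
(`upHalf_radicalTransport`), and by symmetry the rank is constant.

Part 3. The bracket is invariant under c on the whole Grassmannian: it is a sum over i < j of a skew
array with zero row sums, and such sums are unchanged by a cyclic rotation of the indices
(`sum_lt_finRotate`). -/

namespace LusztigGr

/-! ## Combinatorics of permutations -/

section Combinatorics

variable {n : ℕ}

/-- The inversions of u inject into those of u t: apply t to both positions if this keeps their
order, and leave the pair alone otherwise. The new inversion (i, j) is never hit. -/
theorem length_lt_length_mul_swap (u : Equiv.Perm (Fin n)) {i j : Fin n} (hij : i < j)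
    (hu : u i < u j) : length u < length (u * Equiv.swap i j) := by
  classical
  set t := Equiv.swap i j with ht
  have htt : ∀ x, t (t x) = x := fun x => Equiv.swap_apply_self i j x
  have hti : t i = j := Equiv.swap_apply_left i j
  have htj : t j = i := Equiv.swap_apply_right i j
  have hto : ∀ x, x ≠ i → x ≠ j → t x = x := fun x h1 h2 => Equiv.swap_apply_of_ne_of_ne h1 h2
  set I := Finset.univ.filter fun p : Fin n × Fin n => p.1 < p.2 ∧ u p.2 < u p.1 with hI
  set I' := Finset.univ.filter fun p : Fin n × Fin n =>
    p.1 < p.2 ∧ (u * t) p.2 < (u * t) p.1 with hI'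
  have mI : ∀ p q, (p, q) ∈ I ↔ p < q ∧ u q < u p := fun p q => by
    rw [hI, Finset.mem_filter]; exact and_iff_right (Finset.mem_univ _)
  have mI' : ∀ p q, (p, q) ∈ I' ↔ p < q ∧ u (t q) < u (t p) := fun p q => by
    rw [hI', Finset.mem_filter]; exact and_iff_right (Finset.mem_univ _)
  have hmem : (i, j) ∈ I' := (mI' i j).2 ⟨hij, by rwa [hti, htj]⟩
  have key : I.card ≤ (I'.erase (i, j)).card := by
    refine Finset.card_le_card_of_injOn
      (fun p => if t p.1 < t p.2 then (t p.1, t p.2) else p) ?_ ?_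
    · rintro ⟨p, q⟩ hp
      rw [Finset.mem_coe, mI] at hp
      obtain ⟨hpq, hup⟩ := hp
      rw [Finset.mem_coe, Finset.mem_erase]
      by_cases h : t p < t q
      · simp only [h, if_true]
        rw [mI', htt, htt]
        refine ⟨?_, h, hup⟩
        rw [Ne, Prod.mk.injEq]
        rintro ⟨h1, h2⟩
        have h3 : p = j := by rw [← htt p, h1, hti]
        have h4 : q = i := by rw [← htt q, h2, htj]
        subst h3 h4
        exact absurd hpq (not_lt.2 hij.le)
      · simp only [h, if_false]
        rw [mI', Ne, Prod.mk.injEq]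
        refine ⟨?_, hpq, ?_⟩
        · rintro ⟨rfl, rfl⟩
          exact absurd hup (not_lt.2 hu.le)
        · by_cases hpi : p = i
          · subst hpi
            by_cases hqj : q = j
            · subst hqj; rw [hti, htj]; exact hu
            · rw [hti, hto q hpq.ne' hqj]
              exact hup.trans hu
          · by_cases hpj : p = j
            · subst hpj
              rw [htj, hto q (hij.trans hpq).ne' hpq.ne'] at h
              exact absurd (hij.trans hpq) h
            · by_cases hqj : q = j
              · subst hqj
                rw [htj, hto p hpi hpj]
                exact hu.trans hup
              · by_cases hqi : q = i
                · subst hqi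
                  rw [hti, hto p hpi hpj] at h
                  exact absurd (hpq.trans hij) h
                · rwa [hto p hpi hpj, hto q hqi hqj]
    · rintro ⟨p, q⟩ hp ⟨p', q'⟩ hp' heq
      rw [Finset.mem_coe, mI] at hp hp'
      by_cases h : t p < t q <;> by_cases h' : t p' < t q' <;>
        simp only [h, h', if_true, if_false, Prod.mk.injEq] at heq
      · rw [Prod.mk.injEq]
        exact ⟨t.injective heq.1, t.injective heq.2⟩
      · rw [← heq.1, ← heq.2, htt, htt] at h'
        exact absurd hp.1 h'
      · rw [heq.1, heq.2, htt, htt] at h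
        exact absurd hp'.1 h
      · rw [Prod.mk.injEq]; exact heq
  rw [Finset.card_erase_of_mem hmem] at key
  have hpos : 0 < I'.card := Finset.card_pos.2 ⟨_, hmem⟩
  show I.card < I'.card
  omega

theorem length_le_sq (u : Equiv.Perm (Fin n)) : length u ≤ n * n := by
  refine (Finset.card_le_univ _).trans ?_
  simp

/-- The set of all `l < b` with `w l < a`. -/
def corner (w : Equiv.Perm (Fin n)) (a b : ℕ) : Finset (Fin n) :=
  Finset.univ.filter fun l => (l : ℕ) < b ∧ (w l : ℕ) < a

theorem mem_corner {w : Equiv.Perm (Fin n)} {a b : ℕ} {l : Fin n} :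
    l ∈ corner w a b ↔ (l : ℕ) < b ∧ (w l : ℕ) < a := by
  simp [corner]

/-- At the first position i where the values differ, the corner cut just above the smaller value and
just after i has one more element for the permutation taking that value. -/
theorem eq_of_card_corner_eq {v w : Equiv.Perm (Fin n)}
    (h : ∀ a ≤ n, ∀ l : Fin n, (corner v a (l + 1)).card = (corner w a (l + 1)).card) : v = w := by
  have step : ∀ (v w : Equiv.Perm (Fin n)),
      (∀ a ≤ n, ∀ l : Fin n, (corner v a (l + 1)).card = (corner w a (l + 1)).card) →
      ∀ i : Fin n, (∀ l < i, v l = w l) → v i ≤ w i := by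
    intro v w h i hi
    by_contra hlt
    push Not at hlt
    have hsub : corner v (w i + 1) (i + 1) ⊆ (corner w (w i + 1) (i + 1)).erase i := by
      intro l hl
      rw [mem_corner] at hl
      rw [Finset.mem_erase, mem_corner]
      have hne : l ≠ i := by rintro rfl; have := hl.2; rw [Fin.lt_def] at hlt; omega
      have hlt' : l < i := lt_of_le_of_ne (Fin.le_def.2 (by omega)) hne
      exact ⟨hne, hl.1, by rw [← hi l hlt']; exact hl.2⟩
    have hmem : i ∈ corner w (w i + 1) (i + 1) := by simp [mem_corner]
    have := Finset.card_le_card hsub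
    rw [Finset.card_erase_of_mem hmem, h (w i + 1) (w i).2] at this
    have hpos : 0 < (corner w (w i + 1) (i + 1)).card := Finset.card_pos.2 ⟨_, hmem⟩
    omega
  ext1 i
  induction i using WellFoundedLT.induction with
  | ind i ih =>
    exact le_antisymm (step v w h i ih)
      (step w v (fun a ha b => (h a ha b).symm) i (fun l hl => (ih l hl).symm))

/-- The tableau criterion for the Bruhat order. -/
theorem bruhatLE_of_card_corner_le (w : Equiv.Perm (Fin n)) :
    ∀ (m : ℕ) (v : Equiv.Perm (Fin n)), n * n - length v = m →
      (∀ a b : ℕ, (corner w a b).card ≤ (corner v a b).card) → BruhatLE v w := by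
  intro m
  induction m using Nat.strong_induction_on with
  | _ m IH =>
  intro v hm h
  by_cases hvw : v = w
  · subst hvw; exact Relation.ReflTransGen.refl
  have hex : ∃ i, v i ≠ w i := by
    by_contra hcon
    push Not at hcon
    exact hvw (Equiv.ext hcon)
  obtain ⟨i, hi, hmin⟩ := WellFounded.has_min (wellFounded_lt (α := Fin n)) {i | v i ≠ w i} hex
  have heq : ∀ l < i, v l = w l := fun l hl => by
    by_contra hne
    exact hmin l hne hl
  have hlt : v i < w i := by
    by_contra hnot
    have hlt : w i < v i := lt_of_le_of_ne (not_lt.1 hnot) (Ne.symm hi)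
    have hsub : corner v (w i + 1) (i + 1) ⊆ (corner w (w i + 1) (i + 1)).erase i := by
      intro l hl
      rw [mem_corner] at hl
      rw [Finset.mem_erase, mem_corner]
      have hne : l ≠ i := by rintro rfl; have := hl.2; rw [Fin.lt_def] at hlt; omega
      have hlt' : l < i := lt_of_le_of_ne (Fin.le_def.2 (by omega)) hne
      exact ⟨hne, hl.1, by rw [← heq l hlt']; exact hl.2⟩
    have hmem : i ∈ corner w (w i + 1) (i + 1) := by simp [mem_corner]
    have h1 := Finset.card_le_card hsub
    have h2 := h (w i + 1) (i + 1)
    rw [Finset.card_erase_of_mem hmem] at h1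
    have hpos : 0 < (corner w (w i + 1) (i + 1)).card := Finset.card_pos.2 ⟨_, hmem⟩
    omega
  -- Greedy ascent: i is the first disagreement with w, and j will be the first later position with
  -- value in (v i, w i]. Swapping the two raises the length and must preserve the corner
  -- inequalities.
  have hexj : ∃ j, i < j ∧ v i < v j ∧ v j ≤ w i := by
    refine ⟨v.symm (w i), ?_, by simpa using hlt, by simp⟩
    by_contra hnot
    rcases lt_or_eq_of_le (not_lt.1 hnot) with h1 | h1
    · have := heq _ h1
      rw [Equiv.apply_symm_apply] at this
      exact h1.ne (w.injective this.symm)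
    · have h2 := congrArg v h1
      rw [Equiv.apply_symm_apply] at h2
      exact hi h2.symm
  obtain ⟨j, ⟨hij, hvij, hvj⟩, hjmin⟩ :=
    WellFounded.has_min (wellFounded_lt (α := Fin n)) {j | i < j ∧ v i < v j ∧ v j ≤ w i} hexj
  have hlen := length_lt_length_mul_swap v hij hvij
  refine Relation.ReflTransGen.head ⟨i, j, hij.ne, rfl, hlen⟩ ?_
  refine IH (n * n - length (v * Equiv.swap i j)) ?_ _ rfl ?_
  · have := length_le_sq (v * Equiv.swap i j)
    omega
  set t := Equiv.swap i j with ht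
  have htt : ∀ x, t (t x) = x := fun x => Equiv.swap_apply_self i j x
  have hti : t i = j := Equiv.swap_apply_left i j
  have htj : t j = i := Equiv.swap_apply_right i j
  have hto : ∀ x, x ≠ i → x ≠ j → t x = x := fun x h1 h2 => Equiv.swap_apply_of_ne_of_ne h1 h2
  intro a b
  rw [Fin.lt_def] at hij hvij hlt
  rw [Fin.le_def] at hvj
  by_cases hb : (i : ℕ) < b ∧ b ≤ j
  · by_cases ha : (v i : ℕ) < a ∧ a ≤ v j
    · have h1 : (corner v a b).card ≤ (corner (v * t) a b).card + 1 := by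
        refine (Finset.card_le_card (t := insert i (corner (v * t) a b)) ?_).trans
          (Finset.card_insert_le _ _)
        intro l hl
        rw [mem_corner] at hl
        rw [Finset.mem_insert, mem_corner]
        by_cases hli : l = i
        · exact Or.inl hli
        · have hlj : l ≠ j := by rintro rfl; omega
          exact Or.inr ⟨hl.1, by rw [Equiv.Perm.mul_apply, hto l hli hlj]; exact hl.2⟩
      -- In this rectangle the swap costs one point, so a strict inequality at (a, b) is needed; it
      -- comes from the one at (w i + 1, b). By minimality of j, the extra points for v lie before
      -- i, where v = w, hence in T; for w the position i is extra as well.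
      set T : Finset (Fin n) := Finset.univ.filter fun l => l < i ∧ a ≤ (w l : ℕ) ∧ w l ≤ w i
        with hT
      have h2 : (corner v (w i + 1) b).card ≤ (corner v a b).card + T.card := by
        refine (Finset.card_le_card ?_).trans (Finset.card_union_le _ _)
        intro l hl
        rw [mem_corner] at hl
        rw [Finset.mem_union, mem_corner]
        by_cases hla : (v l : ℕ) < a
        · exact Or.inl ⟨hl.1, hla⟩
        · right
          have hli : l < i := by
            by_contra hnot
            have hne : l ≠ i := by rintro rfl; omega
            have hil : i < l := lt_of_le_of_ne (not_lt.1 hnot) (Ne.symm hne)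
            refine hjmin l ⟨hil, Fin.lt_def.2 (by omega), Fin.le_def.2 (by omega)⟩
              (Fin.lt_def.2 (by omega))
          rw [hT, Finset.mem_filter, ← heq l hli]
          exact ⟨Finset.mem_univ _, hli, by omega, Fin.le_def.2 (by omega)⟩
      have h3 : (corner w a b).card + T.card + 1 ≤ (corner w (w i + 1) b).card := by
        have hd : Disjoint (corner w a b) T := by
          rw [Finset.disjoint_left]
          intro l hl hl'
          rw [mem_corner] at hl
          rw [hT, Finset.mem_filter] at hl'
          omega
        have hni : i ∉ corner w a b ∪ T := by
          rw [Finset.mem_union, mem_corner, hT, Finset.mem_filter]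
          rintro (h' | h')
          · omega
          · exact lt_irrefl _ h'.2.1
        rw [← Finset.card_union_of_disjoint hd, ← Finset.card_insert_of_notMem hni]
        refine Finset.card_le_card ?_
        intro l hl
        rw [Finset.mem_insert, Finset.mem_union, mem_corner, hT, Finset.mem_filter] at hl
        rw [mem_corner]
        rcases hl with rfl | hl | ⟨-, hl, -, hl'⟩
        · exact ⟨hb.1, by omega⟩
        · exact ⟨hl.1, by omega⟩
        · rw [Fin.lt_def] at hl
          rw [Fin.le_def] at hl'
          exact ⟨by omega, by omega⟩
      have h4 := h (w i + 1) b
      omega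
    · refine (h a b).trans (Finset.card_le_card ?_)
      intro l hl
      rw [mem_corner] at hl ⊢
      refine ⟨hl.1, ?_⟩
      rw [Equiv.Perm.mul_apply]
      by_cases hli : l = i
      · subst hli; rw [hti]; omega
      · have hlj : l ≠ j := by rintro rfl; omega
        rw [hto l hli hlj]; exact hl.2
  · refine (h a b).trans (Finset.card_le_card_of_injOn t ?_ t.injective.injOn)
    intro l hl
    rw [Finset.mem_coe, mem_corner] at hl ⊢
    rw [Equiv.Perm.mul_apply, htt]
    refine ⟨?_, hl.2⟩
    by_cases hli : l = i
    · subst hli; rw [hti]; omega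
    · by_cases hlj : l = j
      · subst hlj; rw [htj]; omega
      · rw [hto l hli hlj]; exact hl.1

/-- An ascent inside a block could be swapped within the coset, which would lengthen v. -/
theorem IsMaxRep.lt {k : ℕ} {v : Equiv.Perm (Fin n)} (hv : IsMaxRep k v) {i j : Fin n}
    (hij : i < j) (hb : (i : ℕ) < k ↔ (j : ℕ) < k) : v j < v i := by
  by_contra hnot
  have hlt : v i < v j := lt_of_le_of_ne (not_lt.1 hnot) (fun h => hij.ne (v.injective h))
  refine absurd (hv (Equiv.swap i j) fun l => ?_) (not_le.2 (length_lt_length_mul_swap v hij hlt))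
  by_cases hli : l = i
  · subst hli; rw [Equiv.swap_apply_left]; exact hb.symm
  · by_cases hlj : l = j
    · subst hlj; rw [Equiv.swap_apply_right]; exact hb
    · rw [Equiv.swap_apply_of_ne_of_ne hli hlj]

theorem exists_isMaxRep_mul (k : ℕ) (v : Equiv.Perm (Fin n)) :
    ∃ u : Equiv.Perm (Fin n), (∀ i : Fin n, (u i : ℕ) < k ↔ (i : ℕ) < k) ∧ IsMaxRep k (v * u) := by
  classical
  obtain ⟨u, hu, hmax⟩ := Finset.exists_max_image
    (Finset.univ.filter fun u : Equiv.Perm (Fin n) => ∀ i : Fin n, (u i : ℕ) < k ↔ (i : ℕ) < k)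
    (fun u => length (v * u)) ⟨1, by simp⟩
  rw [Finset.mem_filter] at hu
  refine ⟨u, hu.2, fun u' hu' => ?_⟩
  rw [mul_assoc]
  refine hmax _ (Finset.mem_filter.2 ⟨Finset.mem_univ _, fun i => ?_⟩)
  rw [Equiv.Perm.mul_apply, hu.2, hu']

end Combinatorics

/-! ## Bruhat cells and the Bruhat decomposition -/

section Bruhat

variable {n : ℕ}

theorem permGL_mulVec (w : Equiv.Perm (Fin n)) (x : Fin n → ℂ) (i : Fin n) :
    ((permGL n w : Matrix (Fin n) (Fin n) ℂ).mulVec x) (w i) = x i := by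
  simp [Matrix.mulVec, dotProduct, permGL_apply]

theorem mul_permGL_apply (A : Matrix (Fin n) (Fin n) ℂ) (w : Equiv.Perm (Fin n)) (i j : Fin n) :
    (A * (permGL n w : Matrix (Fin n) (Fin n) ℂ)) i j = A i (w j) := by
  simp [Matrix.mul_apply, permGL_apply]

theorem permGL_mul_apply (A : Matrix (Fin n) (Fin n) ℂ) (w : Equiv.Perm (Fin n)) (i j : Fin n) :
    ((permGL n w : Matrix (Fin n) (Fin n) ℂ) * A) (w i) j = A i j := by
  simp [Matrix.mul_apply, permGL_apply]

/-- `g` lies in the double coset `H w B`. -/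
def InCell (H : Subgroup (GL (Fin n) ℂ)) (w : Equiv.Perm (Fin n)) (g : GL (Fin n) ℂ) : Prop :=
  ∃ h ∈ H, ∃ b ∈ borel n, g = h * permGL n w * b

theorem InCell.mul_right {H : Subgroup (GL (Fin n) ℂ)} {w : Equiv.Perm (Fin n)}
    {g b : GL (Fin n) ℂ} (hg : InCell H w g) (hb : b ∈ borel n) : InCell H w (g * b) := by
  obtain ⟨h, hh, b', hb', rfl⟩ := hg
  exact ⟨h, hh, b' * b, mul_mem hb' hb, by group⟩

theorem InCell.mul_left {H : Subgroup (GL (Fin n) ℂ)} {w : Equiv.Perm (Fin n)}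
    {g h : GL (Fin n) ℂ} (hg : InCell H w g) (hh : h ∈ H) : InCell H w (h * g) := by
  obtain ⟨h', hh', b', hb', rfl⟩ := hg
  exact ⟨h * h', mul_mem hh hh', b', hb', by group⟩

theorem exists_pivot {α : Type*} [LinearOrder α] (b : Fin n → α) {y : Fin n → ℂ} (hy : y ≠ 0) :
    ∃ p, y p ≠ 0 ∧ ∀ i, b p < b i → y i = 0 := by
  classical
  obtain ⟨i, hi⟩ := Function.ne_iff.1 hy
  obtain ⟨p, hp, hmax⟩ := Finset.exists_max_image (Finset.univ.filter fun i => y i ≠ 0) b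
    ⟨i, Finset.mem_filter.2 ⟨Finset.mem_univ _, hi⟩⟩
  refine ⟨p, (Finset.mem_filter.1 hp).2, fun l hl => ?_⟩
  by_contra hne
  exact absurd hl (not_lt.2 (hmax l (Finset.mem_filter.2 ⟨Finset.mem_univ _, hne⟩)))

/-- The Bruhat decomposition. -/
theorem exists_inCell {α : Type*} [LinearOrder α] (b : Fin n → α) (hb : Function.Injective b)
    (g : GL (Fin n) ℂ) : ∃ w, InCell (blockTriangularSubgroup n b) w g := by
  classical
  set M : Matrix (Fin n) (Fin n) ℂ := (g : Matrix (Fin n) (Fin n) ℂ) with hM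
  have hinj : Function.Injective M.mulVec := Matrix.mulVec_injective_of_isUnit g.isUnit
  have hne : ∀ x : Fin n → ℂ, x ≠ 0 → M.mulVec x ≠ 0 := fun x hx h =>
    hx (hinj (h.trans (Matrix.mulVec_zero M).symm))
  -- Column reduction as a minimization: A j holds the possible j-th columns of a unipotent upper
  -- triangular matrix, and p j will be the lowest pivot (in the order of `b`) that g attains on A
  -- j.
  let A : Fin n → Set (Fin n → ℂ) := fun j => {x | x j = 1 ∧ ∀ i, j < i → x i = 0}
  let Piv : (Fin n → ℂ) → Fin n → Prop := fun y p => y p ≠ 0 ∧ ∀ i, b p < b i → y i = 0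
  have hA : ∀ j, ∀ x ∈ A j, x ≠ 0 := by
    rintro j x hx rfl
    exact zero_ne_one hx.1
  have hex : ∀ j, ∃ p, (∃ x ∈ A j, Piv (M.mulVec x) p) ∧
      ∀ p', (∃ x ∈ A j, Piv (M.mulVec x) p') → b p ≤ b p' := by
    intro j
    have hmem : (Pi.single j 1 : Fin n → ℂ) ∈ A j :=
      ⟨by simp, fun i hi => by simp [hi.ne']⟩
    obtain ⟨p₀, hp₀⟩ := exists_pivot b (hne _ (hA j _ hmem))
    obtain ⟨p, hp, hmin⟩ := Set.exists_min_image {p | ∃ x ∈ A j, Piv (M.mulVec x) p} b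
      (Set.toFinite _) ⟨p₀, _, hmem, hp₀⟩
    exact ⟨p, hp, hmin⟩
  choose p hp hmin using hex
  choose x hxA hxp using hp
  have hlt : ∀ i j, i < j → p i ≠ p j := by
    intro i j hij heq
    -- This multiple cancels the common pivot, so the new vector of A j has a lower pivot, against
    -- the minimality of p j.
    set c : ℂ := M.mulVec (x j) (p j) / M.mulVec (x i) (p j) with hc
    have hx' : x j - c • x i ∈ A j := by
      refine ⟨?_, fun l hl => ?_⟩
      · simp [(hxA j).1, (hxA i).2 j hij]
      · simp [(hxA j).2 l hl, (hxA i).2 l (hij.trans hl)]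
    obtain ⟨p', hp'⟩ := exists_pivot b (hne _ (hA j _ hx'))
    have hle := hmin j p' ⟨_, hx', hp'⟩
    have hval : ∀ l, M.mulVec (x j - c • x i) l = M.mulVec (x j) l - c * M.mulVec (x i) l := by
      intro l
      rw [Matrix.mulVec_sub, Matrix.mulVec_smul]; rfl
    have hi0 : M.mulVec (x i) (p j) ≠ 0 := heq ▸ (hxp i).1
    refine hp'.1 ?_
    rw [hval]
    rcases hle.lt_or_eq with h | h
    · rw [(hxp j).2 p' h, (hxp i).2 p' (heq ▸ h)]; simp
    · rw [← hb h, hc, div_mul_cancel₀ _ hi0, sub_self]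
  have hpinj : Function.Injective p := by
    intro i j h
    by_contra hij
    rcases lt_or_gt_of_ne hij with h' | h'
    · exact hlt i j h' h
    · exact hlt j i h' h.symm
  set N : Matrix (Fin n) (Fin n) ℂ := Matrix.of fun i j => x j i with hN
  have hNt : N.BlockTriangular id := fun i j hij => (hxA j).2 i hij
  have hdet : N.det ≠ 0 := by
    rw [Matrix.det_of_isUpperTriangular hNt]
    refine Finset.prod_ne_zero_iff.2 fun j _ => ?_
    rw [hN, Matrix.of_apply, (hxA j).1]
    exact one_ne_zero
  set β : GL (Fin n) ℂ := Matrix.GeneralLinearGroup.mkOfDetNeZero N hdet with hβ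
  have hβB : β ∈ borel n := hNt
  set w : Equiv.Perm (Fin n) := Equiv.ofBijective p (Finite.injective_iff_bijective.1 hpinj)
    with hw
  refine ⟨w, g * β * permGL n w⁻¹, ?_, β⁻¹, inv_mem hβB, ?_⟩
  · intro i m hm
    show ((M * N) * (permGL n w⁻¹ : Matrix (Fin n) (Fin n) ℂ)) i m = 0
    rw [mul_permGL_apply]
    have hpw : p (w⁻¹ m) = m := Equiv.apply_symm_apply w m
    have := (hxp (w⁻¹ m)).2 i (by rwa [hpw])
    rw [← this]
    rfl
  · rw [map_inv]; group

end Bruhat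

/-! ## Flags and coordinate subspaces -/

section Flags

variable {n : ℕ}

/-- The linear automorphism of `ℂⁿ` given by an invertible matrix. -/
noncomputable def act (g : GL (Fin n) ℂ) : (Fin n → ℂ) ≃ₗ[ℂ] (Fin n → ℂ) :=
  LinearMap.GeneralLinearGroup.generalLinearEquiv ℂ (Fin n → ℂ)
    (Matrix.GeneralLinearGroup.toLin g)

theorem act_apply (g : GL (Fin n) ℂ) (x : Fin n → ℂ) :
    act g x = (g : Matrix (Fin n) (Fin n) ℂ).mulVec x := by
  rfl

/-- The translate of a subspace of `ℂⁿ` by an invertible matrix. -/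
noncomputable def translate (g : GL (Fin n) ℂ) (W : Submodule ℂ (Fin n → ℂ)) :
    Submodule ℂ (Fin n → ℂ) :=
  W.map (act g).toLinearMap

theorem translate_mul (g h : GL (Fin n) ℂ) (W : Submodule ℂ (Fin n → ℂ)) :
    translate (g * h) W = translate g (translate h W) := by
  unfold translate
  rw [← Submodule.map_comp]
  congr 1
  refine LinearMap.ext fun x => ?_
  simp only [LinearMap.comp_apply, LinearEquiv.coe_coe, act_apply, Matrix.mulVec_mulVec]
  rfl

theorem translate_one (W : Submodule ℂ (Fin n → ℂ)) : translate 1 W = W := by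
  have : (act (1 : GL (Fin n) ℂ)).toLinearMap = LinearMap.id := by
    refine LinearMap.ext fun x => ?_
    simp [act_apply]
  rw [translate, this, Submodule.map_id]

theorem translate_inf (g : GL (Fin n) ℂ) (W W' : Submodule ℂ (Fin n → ℂ)) :
    translate g (W ⊓ W') = translate g W ⊓ translate g W' :=
  Submodule.map_inf _ (act g).injective

theorem translate_sup (g : GL (Fin n) ℂ) (W W' : Submodule ℂ (Fin n → ℂ)) :
    translate g (W ⊔ W') = translate g W ⊔ translate g W' :=
  Submodule.map_sup _ _ _

theorem finrank_translate (g : GL (Fin n) ℂ) (W : Submodule ℂ (Fin n → ℂ)) :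
    Module.finrank ℂ (translate g W) = Module.finrank ℂ W :=
  LinearEquiv.finrank_map_eq (act g) W

/-- The subspace of vectors supported in `S`. -/
noncomputable abbrev coord (S : Set (Fin n)) : Submodule ℂ (Fin n → ℂ) := Pi.spanSubset ℂ S

theorem coord_inter (S T : Set (Fin n)) : coord (S ∩ T) = coord S ⊓ coord T := by
  ext x
  rw [Submodule.mem_inf]
  simp only [Pi.mem_spanSubset_iff, Set.mem_inter_iff, not_and_or]
  exact ⟨fun h => ⟨fun i hi => h i (Or.inl hi), fun i hi => h i (Or.inr hi)⟩,
    fun h i hi => hi.elim (h.1 i) (h.2 i)⟩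

theorem coord_union (S T : Set (Fin n)) : coord (S ∪ T) = coord S ⊔ coord T := by
  rw [coord, Pi.spanSubset, Set.image_union, Submodule.span_union]
  rfl

theorem coord_univ : coord (Set.univ : Set (Fin n)) = ⊤ := by
  ext x; simp [Pi.mem_spanSubset_iff]

theorem coord_empty : coord (∅ : Set (Fin n)) = ⊥ := by
  simp [coord, Pi.spanSubset]

theorem translate_permGL_coord (w : Equiv.Perm (Fin n)) (S : Set (Fin n)) :
    translate (permGL n w) (coord S) = coord (w '' S) := by
  have key : ∀ (w : Equiv.Perm (Fin n)) (S : Set (Fin n)),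
      translate (permGL n w) (coord S) ≤ coord (w '' S) := by
    rintro w S _ ⟨x, hx, rfl⟩
    rw [Pi.mem_spanSubset_iff]
    intro i hi
    obtain ⟨j, rfl⟩ := w.surjective i
    rw [LinearEquiv.coe_coe, act_apply, permGL_mulVec]
    exact Pi.mem_spanSubset_iff.1 hx j fun hj => hi ⟨j, hj, rfl⟩
  refine le_antisymm (key w S) ?_
  have h := Submodule.map_mono (f := (act (permGL n w)).toLinearMap) (key w⁻¹ (w '' S))
  change translate _ (translate _ _) ≤ translate _ _ at h
  rwa [← translate_mul, ← map_mul, mul_inv_cancel, map_one, translate_one, Set.image_image,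
    show (fun x => w⁻¹ (w x)) '' S = S by simp] at h

theorem translate_coord_of_blockTriangular {α : Type*} [LinearOrder α] {b : Fin n → α}
    {h : GL (Fin n) ℂ} (hh : h ∈ blockTriangularSubgroup n b) {S : Set (Fin n)}
    (hS : ∀ i j, b i ≤ b j → j ∈ S → i ∈ S) : translate h (coord S) = coord S := by
  have key : ∀ h ∈ blockTriangularSubgroup n b, translate h (coord S) ≤ coord S := by
    rintro h hh _ ⟨x, hx, rfl⟩
    rw [Pi.mem_spanSubset_iff]
    intro i hi
    rw [LinearEquiv.coe_coe, act_apply]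
    change ∑ j, (h : Matrix (Fin n) (Fin n) ℂ) i j * x j = 0
    refine Finset.sum_eq_zero fun j _ => ?_
    by_cases hj : j ∈ S
    · have hlt : b j < b i := by
        by_contra hnot
        exact hi (hS i j (not_lt.1 hnot) hj)
      rw [hh hlt, zero_mul]
    · rw [Pi.mem_spanSubset_iff.1 hx j hj, mul_zero]
  refine le_antisymm (key h hh) ?_
  have h2 := Submodule.map_mono (f := (act h).toLinearMap) (key h⁻¹ (inv_mem hh))
  change translate _ (translate _ _) ≤ translate _ _ at h2
  rwa [← translate_mul, mul_inv_cancel, translate_one] at h2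

/-- The first `a` indices. -/
def lo (n a : ℕ) : Set (Fin n) := {i | (i : ℕ) < a}

/-- The indices from `a` on. -/
def hi (n a : ℕ) : Set (Fin n) := {i | a ≤ (i : ℕ)}

theorem mem_lo {a : ℕ} {i : Fin n} : i ∈ lo n a ↔ (i : ℕ) < a := Iff.rfl

theorem mem_hi {a : ℕ} {i : Fin n} : i ∈ hi n a ↔ a ≤ (i : ℕ) := Iff.rfl

theorem ncard_lo {a : ℕ} (ha : a ≤ n) : (lo n a).ncard = a := by
  have : lo n a = Set.range (Fin.castLE ha) := by
    ext i
    exact ⟨fun h => ⟨⟨i, h⟩, rfl⟩, by rintro ⟨j, rfl⟩; exact j.2⟩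
  rw [this, ← Set.image_univ, Set.ncard_image_of_injective _ (Fin.castLE_injective ha)]
  simp [Set.ncard_univ]

/-- A lower set of `Fin n` is an initial segment. -/
theorem eq_lo_ncard {S : Set (Fin n)} (hS : IsLowerSet S) : S = lo n S.ncard := by
  have : ∃ a ≤ n, S = lo n a := by
    by_cases hne : ∃ i, i ∉ S
    · obtain ⟨i, hi, hmin⟩ := WellFounded.has_min (wellFounded_lt (α := Fin n)) {i | i ∉ S} hne
      refine ⟨i, i.2.le, Set.ext fun j => ⟨fun hj => ?_, fun hj => ?_⟩⟩
      · by_contra hnot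
        exact hi (hS (not_lt.1 hnot) hj)
      · by_contra hnot
        exact hmin j hnot hj
    · push Not at hne
      exact ⟨n, le_rfl, Set.ext fun j => ⟨fun _ => j.2, fun _ => hne j⟩⟩
  obtain ⟨a, ha, rfl⟩ := this
  rw [ncard_lo ha]

theorem translate_lo {b : GL (Fin n) ℂ} (hb : b ∈ borel n) (a : ℕ) :
    translate b (coord (lo n a)) = coord (lo n a) :=
  translate_coord_of_blockTriangular hb fun i j hij hj => by
    have h : i ≤ j := hij
    rw [mem_lo] at hj ⊢
    exact lt_of_le_of_lt h hj

theorem translate_hi {b : GL (Fin n) ℂ} (hb : b ∈ borelOpp n) (a : ℕ) :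
    translate b (coord (hi n a)) = coord (hi n a) :=
  translate_coord_of_blockTriangular hb fun i j hij hj => by
    have h : j ≤ i := hij
    rw [mem_hi] at hj ⊢
    exact le_trans hj h

theorem translate_lo_of_parabolic {k : ℕ} {p : GL (Fin n) ℂ} (hp : p ∈ parabolic k n) :
    translate p (coord (lo n k)) = coord (lo n k) :=
  translate_coord_of_blockTriangular hp fun i j hij hj => by
    have hj' : (j : ℕ) < k := hj
    by_contra hnot
    have hi' : ¬ (i : ℕ) < k := hnot
    simp [hj', hi'] at hij

/-- The `j`-th step of the flag of `g`: the span of the first `j` columns. -/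
noncomputable def flag (g : GL (Fin n) ℂ) (j : ℕ) : Submodule ℂ (Fin n → ℂ) :=
  translate g (coord (lo n j))

theorem flag_mul_borel (g : GL (Fin n) ℂ) {b : GL (Fin n) ℂ} (hb : b ∈ borel n) (j : ℕ) :
    flag (g * b) j = flag g j := by
  rw [flag, translate_mul, translate_lo hb, flag]

theorem flag_mul_parabolic {k : ℕ} (g : GL (Fin n) ℂ) {p : GL (Fin n) ℂ}
    (hp : p ∈ parabolic k n) : flag (g * p) k = flag g k := by
  rw [flag, translate_mul, translate_lo_of_parabolic hp, flag]

theorem flag_cell {h b : GL (Fin n) ℂ} (w : Equiv.Perm (Fin n)) (hb : b ∈ borel n) (j : ℕ) :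
    flag (h * permGL n w * b) j = translate h (coord (w '' lo n j)) := by
  rw [flag_mul_borel _ hb, flag, translate_mul, translate_permGL_coord]

theorem finrank_flag (g : GL (Fin n) ℂ) {j : ℕ} (hj : j ≤ n) :
    Module.finrank ℂ (flag g j) = j := by
  rw [flag, finrank_translate, Pi.dim_spanSubset, ncard_lo hj]

theorem finrank_coord_image_inter (w : Equiv.Perm (Fin n)) (a j : ℕ) :
    (w '' lo n j ∩ lo n a).ncard = (corner w a j).card := by
  have : w '' lo n j ∩ lo n a = w '' (corner w a j : Set (Fin n)) := by
    ext i
    obtain ⟨l, rfl⟩ := w.surjective i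
    simp [lo, mem_corner]
  rw [this, Set.ncard_image_of_injective _ w.injective, Set.ncard_coe_finset]

theorem InCell.finrank_flag_inf_lo {w : Equiv.Perm (Fin n)} {g : GL (Fin n) ℂ}
    (hg : InCell (borel n) w g) (a j : ℕ) :
    Module.finrank ℂ ↥(flag g j ⊓ coord (lo n a)) = (corner w a j).card := by
  obtain ⟨h, hh, b, hb, rfl⟩ := hg
  rw [flag_cell w hb, ← translate_lo hh a, ← translate_inf, finrank_translate, ← coord_inter,
    Pi.dim_spanSubset, finrank_coord_image_inter]

/-- Since v decreases on the first block, the positions l < k with v l ≥ a form an initial segment,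
so the intersection is a step of the flag. The second claim shows that v fixes its dimension and can
be recovered from it. -/
theorem InCell.flag_inf_hi {k : ℕ} {v : Equiv.Perm (Fin n)} (hv : IsMaxRep k v)
    {g : GL (Fin n) ℂ} (hg : InCell (borelOpp n) v g) (a : ℕ) :
    flag g k ⊓ coord (hi n a) = flag g (Module.finrank ℂ ↥(flag g k ⊓ coord (hi n a))) ∧
    {l : Fin n | (l : ℕ) < k ∧ a ≤ (v l : ℕ)} =
      lo n (Module.finrank ℂ ↥(flag g k ⊓ coord (hi n a))) := by
  obtain ⟨h, hh, b, hb, rfl⟩ := hg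
  set S : Set (Fin n) := {l : Fin n | (l : ℕ) < k ∧ a ≤ (v l : ℕ)} with hS
  have hlow : IsLowerSet S := by
    rintro i j hji ⟨hi1, hi2⟩
    rcases hji.lt_or_eq with hlt | rfl
    · have hj : (j : ℕ) < k := lt_trans hlt hi1
      exact ⟨hj, hi2.trans (hv.lt hlt (iff_of_true hj hi1)).le⟩
    · exact ⟨hi1, hi2⟩
  have h1 : flag (h * permGL n v * b) k ⊓ coord (hi n a) = translate h (coord (v '' S)) := by
    rw [flag_cell v hb, ← translate_hi hh a, ← translate_inf, ← coord_inter]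
    congr 2
    ext i
    obtain ⟨l, rfl⟩ := v.surjective i
    simp [lo, hi, hS]
  rw [h1, finrank_translate, Pi.dim_spanSubset, Set.ncard_image_of_injective _ v.injective,
    flag_cell v hb, ← eq_lo_ncard hlow]
  exact ⟨rfl, rfl⟩

/-- The dual count for the second block: all l < k together with the l satisfying v l ≥ a again form
an initial segment. -/
theorem InCell.flag_sup_hi {k : ℕ} {v : Equiv.Perm (Fin n)} (hv : IsMaxRep k v)
    {g : GL (Fin n) ℂ} (hg : InCell (borelOpp n) v g) (a : ℕ) :
    flag g k ⊔ coord (hi n a) = flag g (Module.finrank ℂ ↥(flag g k ⊔ coord (hi n a))) ∧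
    {l : Fin n | (l : ℕ) < k ∨ a ≤ (v l : ℕ)} =
      lo n (Module.finrank ℂ ↥(flag g k ⊔ coord (hi n a))) := by
  obtain ⟨h, hh, b, hb, rfl⟩ := hg
  set S : Set (Fin n) := {l : Fin n | (l : ℕ) < k ∨ a ≤ (v l : ℕ)} with hS
  have hlow : IsLowerSet S := by
    intro i j hji hi'
    rcases hji.lt_or_eq with hlt | rfl
    · by_cases hj : (j : ℕ) < k
      · exact Or.inl hj
      · have hik : ¬ (i : ℕ) < k := fun h => hj (lt_trans hlt h)
        exact Or.inr ((hi'.resolve_left hik).trans (hv.lt hlt (iff_of_false hj hik)).le)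
    · exact hi'
  have h1 : flag (h * permGL n v * b) k ⊔ coord (hi n a) = translate h (coord (v '' S)) := by
    rw [flag_cell v hb, ← translate_hi hh a, ← translate_sup, ← coord_union]
    congr 2
    ext i
    obtain ⟨l, rfl⟩ := v.surjective i
    simp [lo, hi, hS]
  rw [h1, finrank_translate, Pi.dim_spanSubset, Set.ncard_image_of_injective _ v.injective,
    flag_cell v hb, ← eq_lo_ncard hlow]
  exact ⟨rfl, rfl⟩

theorem lo_union_hi {a b : ℕ} (h : b ≤ a) : lo n a ∪ hi n b = Set.univ := by
  ext i
  simp only [lo, hi, Set.mem_union, Set.mem_univ, iff_true]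
  show (i : ℕ) < a ∨ b ≤ (i : ℕ)
  omega

theorem lo_inter_hi {a b : ℕ} (h : a ≤ b) : lo n a ∩ hi n b = ∅ := by
  ext i
  simp only [Set.mem_inter_iff, Set.mem_empty_iff_false, iff_false]
  show ¬ ((i : ℕ) < a ∧ b ≤ (i : ℕ))
  omega

/-- The cell of w counts F_j ∩ ℂ^{<a} and the cell of v counts F_j ∩ ℂ^{≥a}. These subspaces of F_j
meet in zero, so their dimensions add up to at most dim F_j, which is the tableau inequality. -/
theorem bruhatLE_of_inCell {v w : Equiv.Perm (Fin n)} {g : GL (Fin n) ℂ}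
    (hv : InCell (borelOpp n) v g) (hw : InCell (borel n) w g) : BruhatLE v w := by
  refine bruhatLE_of_card_corner_le w _ v rfl fun a j => ?_
  rw [← hw.finrank_flag_inf_lo a j]
  obtain ⟨h, hh, b, hb, rfl⟩ := hv
  have h1 : Module.finrank ℂ ↥(flag (h * permGL n v * b) j ⊓ coord (hi n a)) =
      (v '' lo n j ∩ hi n a).ncard := by
    rw [flag_cell v hb, ← translate_hi hh a, ← translate_inf, finrank_translate, ← coord_inter,
      Pi.dim_spanSubset]
  have h2 : Module.finrank ℂ (flag (h * permGL n v * b) j) = (v '' lo n j).ncard := by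
    rw [flag_cell v hb, finrank_translate, Pi.dim_spanSubset]
  have h3 : (v '' lo n j ∩ lo n a).ncard + (v '' lo n j ∩ hi n a).ncard = (v '' lo n j).ncard := by
    rw [← Set.ncard_union_eq, ← Set.inter_union_distrib_left, lo_union_hi le_rfl, Set.inter_univ]
    rw [Set.disjoint_iff_inter_eq_empty, Set.inter_inter_inter_comm, lo_inter_hi le_rfl,
      Set.inter_empty]
  have h4 : Module.finrank ℂ ↥(flag (h * permGL n v * b) j ⊓ coord (lo n a)) +
      Module.finrank ℂ ↥(flag (h * permGL n v * b) j ⊓ coord (hi n a)) ≤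
      Module.finrank ℂ (flag (h * permGL n v * b) j) := by
    rw [← Submodule.finrank_sup_add_finrank_inf_eq, ← inf_inf_distrib_left, ← coord_inter,
      lo_inter_hi le_rfl, coord_empty, inf_bot_eq, finrank_bot, add_zero]
    exact Submodule.finrank_mono (sup_le inf_le_left inf_le_left)
  rw [← finrank_coord_image_inter]
  omega

end Flags

/-! ## Strata and cyclic ranks -/

section CyclicRank

variable {n : ℕ}

theorem mem_lusztigStratum {k : ℕ} {v w : Equiv.Perm (Fin n)} {x : Gr k n} :
    x ∈ lusztigStratum k n v w ↔
      ∃ g : GL (Fin n) ℂ, (g : Gr k n) = x ∧ InCell (borelOpp n) v g ∧ InCell (borel n) w g := by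
  have key : ∀ (H : Subgroup (GL (Fin n) ℂ)) (u : Equiv.Perm (Fin n)) (g : GL (Fin n) ℂ),
      (g : GL (Fin n) ℂ ⧸ borel n) ∈ MulAction.orbit H (permGL n u : GL (Fin n) ℂ ⧸ borel n) ↔
        InCell H u g := by
    intro H u g
    constructor
    · rintro ⟨h, hh⟩
      have hh' : ((h * permGL n u : GL (Fin n) ℂ) : GL (Fin n) ℂ ⧸ borel n) = g := hh
      rw [QuotientGroup.eq] at hh'
      exact ⟨h, h.2, _, hh', by group⟩
    · rintro ⟨h, hh, b, hb, rfl⟩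
      refine ⟨⟨h, hh⟩, ?_⟩
      show ((h * permGL n u : GL (Fin n) ℂ) : GL (Fin n) ℂ ⧸ borel n) = _
      rw [QuotientGroup.eq, ← mul_assoc, inv_mul_cancel, one_mul]
      exact hb
  constructor
  · rintro ⟨y, ⟨hv, hw⟩, rfl⟩
    induction y using QuotientGroup.induction_on with
    | H g => exact ⟨g, rfl, (key _ _ _).1 hv, (key _ _ _).1 hw⟩
  · rintro ⟨g, rfl, hv, hw⟩
    exact ⟨(g : GL (Fin n) ℂ ⧸ borel n), ⟨(key _ _ _).2 hv, (key _ _ _).2 hw⟩, rfl⟩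

/-- Every point of the Grassmannian has a lift in an open Richardson variety with maximal `v`. -/
theorem exists_lift (k : ℕ) (g : GL (Fin n) ℂ) :
    ∃ v w : Equiv.Perm (Fin n), IsMaxRep k v ∧ BruhatLE v w ∧ ∃ p ∈ parabolic k n,
      InCell (borelOpp n) v (g * p) ∧ InCell (borel n) w (g * p) := by
  obtain ⟨v₀, h, hh, b, hb, rfl⟩ := exists_inCell (fun i : Fin n => OrderDual.toDual i)
    (fun _ _ h => h) g
  obtain ⟨u, hu, hv⟩ := exists_isMaxRep_mul k v₀
  have hup : permGL n u ∈ parabolic k n := by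
    intro i j hij
    rw [permGL_apply, if_neg]
    rintro rfl
    simp [hu] at hij
  -- Right multiplication by b⁻¹u ∈ P removes b and replaces v₀ by the maximal representative v₀u
  -- without moving the point of the Grassmannian.
  have hcell : InCell (borelOpp n) (v₀ * u) (h * permGL n v₀ * b * (b⁻¹ * permGL n u)) :=
    ⟨h, hh, 1, one_mem _, by rw [map_mul]; group⟩
  obtain ⟨w, hw⟩ := exists_inCell (fun i : Fin n => i) (fun _ _ h => h)
    (h * permGL n v₀ * b * (b⁻¹ * permGL n u))
  exact ⟨_, w, hv, bruhatLE_of_inCell hcell hw, _,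
    mul_mem (borel_le_parabolic k n (inv_mem hb)) hup, hcell, hw⟩

/-- The cyclic interval `s, s + 1, …, s + l - 1` modulo `n`. -/
def cyclicInterval (n s l : ℕ) : Set (Fin n) := {i | ∃ m < l, (i : ℕ) ≡ s + m [MOD n]}

/-- For a ≤ b the truncated difference is 0 and both sides are empty. -/
theorem hi_inter_lo {a b : ℕ} (ha : a ≤ n) : hi n b ∩ lo n a = cyclicInterval n b (a - b) := by
  ext i
  rw [Set.mem_inter_iff, mem_lo, mem_hi]
  constructor
  · rintro ⟨h1, h2⟩
    exact ⟨i - b, by omega, by rw [Nat.add_sub_cancel' h1]⟩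
  · rintro ⟨m, hm, h⟩
    have := Nat.ModEq.eq_of_lt_of_lt h i.2 (by omega)
    omega

theorem lo_union_hi_eq {a b : ℕ} (hab : a ≤ b) (hb : b ≤ n) :
    lo n a ∪ hi n b = cyclicInterval n b (n - b + a) := by
  ext i
  rw [Set.mem_union, mem_lo, mem_hi]
  have hi := i.2
  constructor
  · rintro (h | h)
    · refine ⟨i + n - b, by omega, ?_⟩
      rw [show b + ((i : ℕ) + n - b) = i + n by omega]
      simp [Nat.ModEq]
    · exact ⟨i - b, by omega, by rw [Nat.add_sub_cancel' h]⟩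
  · rintro ⟨m, hm, h⟩
    by_cases hlt : b + m < n
    · have := Nat.ModEq.eq_of_lt_of_lt h hi hlt
      omega
    · have h' : (i : ℕ) ≡ b + m - n [MOD n] := by
        refine h.trans ?_
        conv_lhs => rw [show b + m = b + m - n + n by omega]
        simp [Nat.ModEq]
      have := Nat.ModEq.eq_of_lt_of_lt h' hi (by omega)
      omega

theorem cyclicInterval_cases (n s l : ℕ) : ∃ a b : ℕ, a ≤ n ∧ b ≤ n ∧
    (cyclicInterval n s l = hi n b ∩ lo n a ∨
      a ≤ b ∧ cyclicInterval n s l = lo n a ∪ hi n b) := by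
  rcases Nat.eq_zero_or_pos n with rfl | hn
  · exact ⟨0, 0, le_rfl, le_rfl, Or.inl (Subsingleton.elim _ _)⟩
  have hmod : cyclicInterval n s l = cyclicInterval n (s % n) l := by
    ext i
    have : ∀ m, s + m ≡ s % n + m [MOD n] := fun m => (Nat.mod_modEq s n).symm.add_right m
    exact ⟨fun ⟨m, hm, h⟩ => ⟨m, hm, h.trans (this m)⟩,
      fun ⟨m, hm, h⟩ => ⟨m, hm, h.trans (this m).symm⟩⟩
  have hs := Nat.mod_lt s hn
  rw [hmod]
  by_cases h1 : n ≤ l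
  · refine ⟨0, 0, Nat.zero_le _, Nat.zero_le _, Or.inr ⟨le_rfl, ?_⟩⟩
    rw [lo_union_hi le_rfl, Set.eq_univ_iff_forall]
    intro i
    have hi := i.2
    by_cases h : s % n ≤ i
    · exact ⟨i - s % n, by omega, by rw [Nat.add_sub_cancel' h]⟩
    · refine ⟨i + n - s % n, by omega, ?_⟩
      rw [show s % n + ((i : ℕ) + n - s % n) = i + n by omega]
      simp [Nat.ModEq]
  · by_cases h2 : s % n + l ≤ n
    · refine ⟨s % n + l, s % n, h2, hs.le, Or.inl ?_⟩
      rw [hi_inter_lo h2, Nat.add_sub_cancel_left]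
    · refine ⟨s % n + l - n, s % n, by omega, hs.le, Or.inr ⟨by omega, ?_⟩⟩
      rw [lo_union_hi_eq (by omega) hs.le]
      congr 1
      omega

/-- By the modular law (V + D) ∩ A and V ∩ (A + D) have the same sum with D, namely (V + D) ∩ (A +
D); the former meets D in zero, the latter in V ∩ D. -/
theorem finrank_sup_inf_add {V A D : Submodule ℂ (Fin n → ℂ)} (h : A ⊓ D = ⊥) :
    Module.finrank ℂ ↥((V ⊔ D) ⊓ A) + Module.finrank ℂ ↥(V ⊓ D) =
      Module.finrank ℂ ↥(V ⊓ (A ⊔ D)) := by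
  have h1 := Submodule.finrank_sup_add_finrank_inf_eq ((V ⊔ D) ⊓ A) D
  have h2 := Submodule.finrank_sup_add_finrank_inf_eq (V ⊓ (A ⊔ D)) D
  rw [inf_assoc, h, inf_bot_eq, finrank_bot] at h1
  rw [inf_assoc, inf_eq_right.2 (le_sup_right : D ≤ A ⊔ D)] at h2
  have h3 : (V ⊔ D) ⊓ A ⊔ D = V ⊓ (A ⊔ D) ⊔ D := by
    rw [sup_comm, inf_comm, ← sup_inf_assoc_of_le A (le_sup_right : D ≤ V ⊔ D),
      sup_comm (V ⊓ (A ⊔ D)), ← sup_inf_assoc_of_le V (le_sup_right : D ≤ A ⊔ D), sup_comm D A,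
      sup_comm D V, inf_comm]
  rw [h3] at h1
  omega

/-- The subspaces given by `g` and `g'` have equal ranks along all cyclic intervals. -/
def CyclicEq (k : ℕ) (g g' : GL (Fin n) ℂ) : Prop :=
  ∀ s l, Module.finrank ℂ ↥(flag g k ⊓ coord (cyclicInterval n s l)) =
    Module.finrank ℂ ↥(flag g' k ⊓ coord (cyclicInterval n s l))

theorem CyclicEq.symm {k : ℕ} {g g' : GL (Fin n) ℂ} (h : CyclicEq k g g') : CyclicEq k g' g :=
  fun s l => (h s l).symm

theorem CyclicEq.trans {k : ℕ} {g g' g'' : GL (Fin n) ℂ} (h : CyclicEq k g g')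
    (h' : CyclicEq k g' g'') : CyclicEq k g g'' :=
  fun s l => (h s l).trans (h' s l)

theorem cyclicEq_of_eq {k : ℕ} {g g' : GL (Fin n) ℂ} (h : (g : Gr k n) = g') :
    CyclicEq k g g' := by
  rw [QuotientGroup.eq] at h
  intro s l
  rw [show g' = g * (g⁻¹ * g') by group, flag_mul_parabolic _ h]

theorem lo_injOn {a b : ℕ} (ha : a ≤ n) (hb : b ≤ n) (h : lo n a = lo n b) : a = b := by
  rw [← ncard_lo ha, h, ncard_lo hb]

theorem finrank_le (W : Submodule ℂ (Fin n → ℂ)) : Module.finrank ℂ W ≤ n := by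
  simpa using Submodule.finrank_le W

/-! ### Cyclic ranks in terms of the pair (v, w) -/

theorem finrank_flag_inf_hi_inter_lo (k : ℕ) {v w : Equiv.Perm (Fin n)} (hv : IsMaxRep k v)
    {g : GL (Fin n) ℂ} (hgv : InCell (borelOpp n) v g) (hgw : InCell (borel n) w g) (a b : ℕ) :
    Module.finrank ℂ ↥(flag g k ⊓ coord (hi n b ∩ lo n a)) =
      (corner w a (Module.finrank ℂ ↥(flag g k ⊓ coord (hi n b)))).card := by
  rw [coord_inter, ← inf_assoc]
  conv_lhs => rw [(hgv.flag_inf_hi hv b).1]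
  rw [hgw.finrank_flag_inf_lo]

/-- For an interval that wraps around, `finrank_sup_inf_add` replaces V by V + ℂ^{≥b}, which is
again a step of the flag and so is measured by w. -/
theorem finrank_flag_inf_lo_union_hi (k : ℕ) {v w : Equiv.Perm (Fin n)} (hv : IsMaxRep k v)
    {g : GL (Fin n) ℂ} (hgv : InCell (borelOpp n) v g) (hgw : InCell (borel n) w g) {a b : ℕ}
    (hab : a ≤ b) :
    (corner w a (Module.finrank ℂ ↥(flag g k ⊔ coord (hi n b)))).card +
        Module.finrank ℂ ↥(flag g k ⊓ coord (hi n b)) =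
      Module.finrank ℂ ↥(flag g k ⊓ coord (lo n a ∪ hi n b)) := by
  rw [coord_union, ← finrank_sup_inf_add (by rw [← coord_inter, lo_inter_hi hab, coord_empty]),
    ← hgw.finrank_flag_inf_lo, ← (hgv.flag_sup_hi hv b).1]

/-- When b ≤ a the step V + ℂ^{≥b} and ℂ^{<a} span everything, so the corner count is forced by
dimensions. This supplies the corners of w that no wrapped interval reaches. -/
theorem card_corner_finrank_sup {k : ℕ} {v w : Equiv.Perm (Fin n)} (hv : IsMaxRep k v)
    {g : GL (Fin n) ℂ} (hgv : InCell (borelOpp n) v g) (hgw : InCell (borel n) w g) {a b : ℕ}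
    (ha : a ≤ n) (hab : b ≤ a) :
    n + (corner w a (Module.finrank ℂ ↥(flag g k ⊔ coord (hi n b)))).card =
      Module.finrank ℂ ↥(flag g k ⊔ coord (hi n b)) + a := by
  rw [← hgw.finrank_flag_inf_lo, ← (hgv.flag_sup_hi hv b).1]
  have h := Submodule.finrank_sup_add_finrank_inf_eq (flag g k ⊔ coord (hi n b)) (coord (lo n a))
  rw [sup_assoc, ← coord_union, Set.union_comm, lo_union_hi hab, coord_univ, sup_top_eq,
    finrank_top, Module.finrank_fin_fun, Pi.dim_spanSubset (s := lo n a), ncard_lo ha] at h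
  exact h

theorem cyclicEq_of_inCell {k : ℕ} {v w : Equiv.Perm (Fin n)} (hv : IsMaxRep k v)
    {g g' : GL (Fin n) ℂ} (hgv : InCell (borelOpp n) v g) (hgw : InCell (borel n) w g)
    (hgv' : InCell (borelOpp n) v g') (hgw' : InCell (borel n) w g') : CyclicEq k g g' := by
  have hI : ∀ b, Module.finrank ℂ ↥(flag g k ⊓ coord (hi n b)) =
      Module.finrank ℂ ↥(flag g' k ⊓ coord (hi n b)) := fun b =>
    lo_injOn (finrank_le _) (finrank_le _)
      ((hgv.flag_inf_hi hv b).2.symm.trans (hgv'.flag_inf_hi hv b).2)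
  have hS : ∀ b, Module.finrank ℂ ↥(flag g k ⊔ coord (hi n b)) =
      Module.finrank ℂ ↥(flag g' k ⊔ coord (hi n b)) := fun b =>
    lo_injOn (finrank_le _) (finrank_le _)
      ((hgv.flag_sup_hi hv b).2.symm.trans (hgv'.flag_sup_hi hv b).2)
  intro s l
  obtain ⟨a, b, -, -, h | ⟨hab, h⟩⟩ := cyclicInterval_cases n s l
  · rw [h, finrank_flag_inf_hi_inter_lo k hv hgv hgw, finrank_flag_inf_hi_inter_lo k hv hgv' hgw',
      hI]
  · rw [h, ← finrank_flag_inf_lo_union_hi k hv hgv hgw hab,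
      ← finrank_flag_inf_lo_union_hi k hv hgv' hgw' hab, hI, hS]

/-- The ranks give the dimensions of V ∩ ℂ^{≥b} and V + ℂ^{≥b}, hence v. The step F_{l+1} is V ∩
ℂ^{≥ v l} if l < k and V + ℂ^{≥ v l} otherwise, so the ranks also give every corner count of w. -/
theorem eq_of_cyclicEq {k : ℕ} (hk : k ≤ n) {v w v' w' : Equiv.Perm (Fin n)}
    (hv : IsMaxRep k v) (hv' : IsMaxRep k v') {g g' : GL (Fin n) ℂ}
    (hgv : InCell (borelOpp n) v g) (hgw : InCell (borel n) w g)
    (hgv' : InCell (borelOpp n) v' g') (hgw' : InCell (borel n) w' g') (h : CyclicEq k g g') :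
    v = v' ∧ w = w' := by
  have hint : ∀ a ≤ n, ∀ b, Module.finrank ℂ ↥(flag g k ⊓ coord (hi n b ∩ lo n a)) =
      Module.finrank ℂ ↥(flag g' k ⊓ coord (hi n b ∩ lo n a)) := fun a ha b => by
    rw [hi_inter_lo ha]; exact h _ _
  have hun : ∀ a b, a ≤ b → b ≤ n →
      Module.finrank ℂ ↥(flag g k ⊓ coord (lo n a ∪ hi n b)) =
      Module.finrank ℂ ↥(flag g' k ⊓ coord (lo n a ∪ hi n b)) := fun a b hab hb => by
    rw [lo_union_hi_eq hab hb]; exact h _ _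
  have hI : ∀ b, Module.finrank ℂ ↥(flag g k ⊓ coord (hi n b)) =
      Module.finrank ℂ ↥(flag g' k ⊓ coord (hi n b)) := fun b => by
    have hlo : hi n b ∩ lo n n = hi n b := Set.inter_eq_left.2 fun i _ => i.2
    have := hint n le_rfl b
    rwa [hlo] at this
  have hS : ∀ b, Module.finrank ℂ ↥(flag g k ⊔ coord (hi n b)) =
      Module.finrank ℂ ↥(flag g' k ⊔ coord (hi n b)) := fun b => by
    have h1 := Submodule.finrank_sup_add_finrank_inf_eq (flag g k) (coord (hi n b))
    have h2 := Submodule.finrank_sup_add_finrank_inf_eq (flag g' k) (coord (hi n b))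
    rw [finrank_flag _ hk] at h1 h2
    have := hI b
    omega
  have hvv : v = v' := by
    have key : ∀ (l : Fin n) (a : ℕ), a ≤ (v l : ℕ) ↔ a ≤ (v' l : ℕ) := by
      intro l a
      by_cases hl : (l : ℕ) < k
      · have h1 := Set.ext_iff.1 (hgv.flag_inf_hi hv a).2 l
        have h2 := Set.ext_iff.1 (hgv'.flag_inf_hi hv' a).2 l
        rw [← hI] at h2
        simpa [hl] using h1.trans h2.symm
      · have h1 := Set.ext_iff.1 (hgv.flag_sup_hi hv a).2 l
        have h2 := Set.ext_iff.1 (hgv'.flag_sup_hi hv' a).2 l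
        rw [← hS] at h2
        simpa [hl] using h1.trans h2.symm
    ext l
    exact le_antisymm ((key l _).1 le_rfl) ((key l _).2 le_rfl)
  subst hvv
  refine ⟨rfl, eq_of_card_corner_eq fun a ha l => ?_⟩
  have hlow : ∀ m : Fin n, ((m : ℕ) < k ↔ (l : ℕ) < k) → (v l ≤ v m ↔ m ≤ l) := by
    intro m hm
    constructor
    · intro hle
      by_contra hlt
      exact absurd hle (not_le.2 (hv.lt (not_le.1 hlt) hm.symm))
    · intro hle
      rcases hle.lt_or_eq with hlt | rfl
      · exact (hv.lt hlt hm).le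
      · exact le_rfl
  by_cases hl : (l : ℕ) < k
  · have hset : {m : Fin n | (m : ℕ) < k ∧ (v l : ℕ) ≤ (v m : ℕ)} = lo n (l + 1) := by
      ext m
      show ((m : ℕ) < k ∧ v l ≤ v m) ↔ (m : ℕ) < l + 1
      constructor
      · rintro ⟨h1, h2⟩
        exact Nat.lt_succ_of_le ((hlow m (iff_of_true h1 hl)).1 h2)
      · intro h1
        have h2 : (m : ℕ) < k := by omega
        exact ⟨h2, (hlow m (iff_of_true h2 hl)).2 (Fin.le_def.2 (by omega))⟩
    have hfin := lo_injOn (Nat.succ_le_of_lt l.2) (finrank_le _)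
      (hset.symm.trans (hgv.flag_inf_hi hv (v l)).2)
    have h1 := hint a ha (v l)
    rw [finrank_flag_inf_hi_inter_lo k hv hgv hgw, finrank_flag_inf_hi_inter_lo k hv hgv' hgw',
      ← hI, ← hfin] at h1
    exact h1
  · have hset : {m : Fin n | (m : ℕ) < k ∨ (v l : ℕ) ≤ (v m : ℕ)} = lo n (l + 1) := by
      ext m
      show ((m : ℕ) < k ∨ v l ≤ v m) ↔ (m : ℕ) < l + 1
      by_cases hm : (m : ℕ) < k
      · exact iff_of_true (Or.inl hm) (by omega)
      · rw [hlow m (iff_of_false hm hl), Fin.le_def]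
        omega
    have hfin := lo_injOn (Nat.succ_le_of_lt l.2) (finrank_le _)
      (hset.symm.trans (hgv.flag_sup_hi hv (v l)).2)
    rcases le_total a (v l : ℕ) with hab | hab
    · have h1 := hun a (v l) hab (v l).2.le
      rw [← finrank_flag_inf_lo_union_hi k hv hgv hgw hab,
        ← finrank_flag_inf_lo_union_hi k hv hgv' hgw' hab, ← hI, ← hS, ← hfin] at h1
      exact Nat.add_right_cancel h1
    · have h1 := card_corner_finrank_sup hv hgv hgw ha hab
      have h2 := card_corner_finrank_sup hv hgv' hgw' ha hab
      rw [← hS, ← hfin] at h2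
      rw [← hfin] at h1
      rw [Nat.succ_eq_add_one] at h1 h2
      omega

/-- The set of all points with the same cyclic ranks as `g`. -/
def cyclicClass (k : ℕ) (g : GL (Fin n) ℂ) : Set (Gr k n) :=
  {x | ∃ h : GL (Fin n) ℂ, (h : Gr k n) = x ∧ CyclicEq k g h}

theorem mk_mem_cyclicClass {k : ℕ} {g h : GL (Fin n) ℂ} :
    (h : Gr k n) ∈ cyclicClass k g ↔ CyclicEq k g h :=
  ⟨fun ⟨_, h1, h2⟩ => h2.trans (cyclicEq_of_eq h1), fun h1 => ⟨h, rfl, h1⟩⟩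

/-- A point with the ranks of g lies in some stratum by `exists_lift`, and `eq_of_cyclicEq` forces
the pair of that stratum to be (v, w). -/
theorem lusztigStratum_eq_cyclicClass {k : ℕ} (hk : k ≤ n) {v w : Equiv.Perm (Fin n)}
    (hv : IsMaxRep k v) {g : GL (Fin n) ℂ} (hg : (g : Gr k n) ∈ lusztigStratum k n v w) :
    lusztigStratum k n v w = cyclicClass k g := by
  obtain ⟨g₁, h1, hgv, hgw⟩ := mem_lusztigStratum.1 hg
  have h2 := cyclicEq_of_eq h1
  ext x
  induction x using QuotientGroup.induction_on with
  | H h =>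
  rw [mk_mem_cyclicClass]
  constructor
  · intro hh
    obtain ⟨g₂, h3, hgv', hgw'⟩ := mem_lusztigStratum.1 hh
    exact h2.symm.trans ((cyclicEq_of_inCell hv hgv hgw hgv' hgw').trans (cyclicEq_of_eq h3))
  · intro hh
    obtain ⟨v', w', hv', -, p, hp, hgv', hgw'⟩ := exists_lift k h
    have hhp : ((h * p : GL (Fin n) ℂ) : Gr k n) = h := by
      rw [QuotientGroup.eq]; simpa using hp
    obtain ⟨rfl, rfl⟩ := eq_of_cyclicEq hk hv hv' hgv hgw hgv' hgw'
      (h2.trans (hh.trans (cyclicEq_of_eq hhp.symm)))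
    exact mem_lusztigStratum.2 ⟨_, hhp, hgv', hgw'⟩

theorem cyclicClass_mem_lusztigStrata {k : ℕ} (hk : k ≤ n) (g : GL (Fin n) ℂ) :
    cyclicClass k g ∈ lusztigStrata k n := by
  obtain ⟨v, w, hv, hvw, p, hp, hgv, hgw⟩ := exists_lift k g
  have hgp : ((g * p : GL (Fin n) ℂ) : Gr k n) = g := by
    rw [QuotientGroup.eq]; simpa using hp
  exact ⟨v, w, hv, hvw,
    (lusztigStratum_eq_cyclicClass hk hv (mem_lusztigStratum.2 ⟨_, hgp, hgv, hgw⟩)).symm⟩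

/-! ### Rotation of cyclic intervals -/

theorem finRotate_modEq (i : Fin n) : ((finRotate n i : Fin n) : ℕ) ≡ i + 1 [MOD n] := by
  cases n with
  | zero => exact i.elim0
  | succ m =>
    rw [finRotate_apply, Fin.val_add, Fin.val_one', Nat.ModEq, Nat.mod_mod, Nat.add_mod_mod]

theorem finRotate_image_cyclicInterval (s l : ℕ) :
    finRotate n '' cyclicInterval n s l = cyclicInterval n (s + 1) l := by
  ext i
  obtain ⟨j, rfl⟩ := (finRotate n).surjective i
  rw [(finRotate n).injective.mem_set_image]
  have key : ∀ m, ((j : ℕ) ≡ s + m [MOD n] ↔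
      ((finRotate n j : Fin n) : ℕ) ≡ s + 1 + m [MOD n]) := by
    intro m
    rw [show s + 1 + m = s + m + 1 by ring]
    exact ⟨fun h => (finRotate_modEq j).trans (h.add_right 1),
      fun h => Nat.ModEq.add_right_cancel' 1 ((finRotate_modEq j).symm.trans h)⟩
  exact ⟨fun ⟨m, hm, h⟩ => ⟨m, hm, (key m).1 h⟩, fun ⟨m, hm, h⟩ => ⟨m, hm, (key m).2 h⟩⟩

theorem finrank_flag_coxeter_inf (k : ℕ) (g : GL (Fin n) ℂ) (s l : ℕ) :
    Module.finrank ℂ ↥(flag (coxeter n * g) k ⊓ coord (cyclicInterval n (s + 1) l)) =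
      Module.finrank ℂ ↥(flag g k ⊓ coord (cyclicInterval n s l)) := by
  rw [flag, translate_mul, ← finRotate_image_cyclicInterval, ← translate_permGL_coord, coxeter,
    ← translate_inf, finrank_translate, flag]

theorem cyclicEq_coxeter_mul {k : ℕ} {g h : GL (Fin n) ℂ} :
    CyclicEq k (coxeter n * g) (coxeter n * h) ↔ CyclicEq k g h := by
  constructor
  · intro H s l
    rw [← finrank_flag_coxeter_inf k g, ← finrank_flag_coxeter_inf k h, H]
  · intro H s l
    rcases Nat.eq_zero_or_pos n with rfl | hn
    · rw [Subsingleton.elim (coxeter 0 * g) (coxeter 0 * h)]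
    -- The start s is rewritten as a successor modulo n, so that the shift formula applies even for
    -- s = 0.
    have : cyclicInterval n s l = cyclicInterval n (s + n - 1 + 1) l := by
      ext i
      rw [Nat.sub_add_cancel (by omega)]
      have : ∀ m, s + n + m ≡ s + m [MOD n] := fun m => by
        rw [show s + n + m = s + m + n by ring]; simp [Nat.ModEq]
      exact ⟨fun ⟨m, hm, h⟩ => ⟨m, hm, h.trans (this m).symm⟩,
        fun ⟨m, hm, h⟩ => ⟨m, hm, h.trans (this m)⟩⟩
    rw [this, finrank_flag_coxeter_inf, finrank_flag_coxeter_inf, H]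

theorem coxeter_image_cyclicClass (k : ℕ) (g : GL (Fin n) ℂ) :
    (fun x : Gr k n => coxeter n • x) '' cyclicClass k g = cyclicClass k (coxeter n * g) := by
  ext x
  constructor
  · rintro ⟨_, ⟨h, rfl, hh⟩, rfl⟩
    exact ⟨coxeter n * h, rfl, cyclicEq_coxeter_mul.2 hh⟩
  · rintro ⟨h, rfl, hh⟩
    refine ⟨(((coxeter n)⁻¹ * h : GL (Fin n) ℂ) : Gr k n),
      ⟨_, rfl, cyclicEq_coxeter_mul.1 (by simpa using hh)⟩, ?_⟩
    show ((coxeter n * ((coxeter n)⁻¹ * h) : GL (Fin n) ℂ) : Gr k n) = h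
    rw [mul_inv_cancel_left]

/-- Nonemptiness of the strata is not needed for the bijection: the empty set, if it occurred, would
be fixed by c. -/
theorem eq_empty_or_cyclicClass {k : ℕ} (hk : k ≤ n) {R : Set (Gr k n)}
    (hR : R ∈ lusztigStrata k n) : R = ∅ ∨ ∃ g : GL (Fin n) ℂ, R = cyclicClass k g := by
  obtain ⟨v, w, hv, -, rfl⟩ := hR
  rcases Set.eq_empty_or_nonempty (lusztigStratum k n v w) with h | ⟨x, hx⟩
  · exact Or.inl h
  · induction x using QuotientGroup.induction_on with
    | H g => exact Or.inr ⟨g, lusztigStratum_eq_cyclicClass hk hv hx⟩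

/-- The Coxeter element permutes the Lusztig strata. -/
theorem bijOn_coxeter {k : ℕ} (hk : k ≤ n) :
    Set.BijOn (fun S : Set (Gr k n) => (fun x => coxeter n • x) '' S)
      (lusztigStrata k n) (lusztigStrata k n) := by
  refine ⟨fun R hR => ?_, fun R _ R' _ h => ?_, fun R hR => ?_⟩
  · rcases eq_empty_or_cyclicClass hk hR with rfl | ⟨g, rfl⟩
    · simpa using hR
    · simp only [coxeter_image_cyclicClass]
      exact cyclicClass_mem_lusztigStrata hk _
  · exact Set.image_injective.2 (MulAction.injective (coxeter n)) h
  · rcases eq_empty_or_cyclicClass hk hR with rfl | ⟨g, rfl⟩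
    · exact ⟨∅, hR, Set.image_empty _⟩
    · refine ⟨cyclicClass k ((coxeter n)⁻¹ * g), cyclicClass_mem_lusztigStrata hk _, ?_⟩
      simp only [coxeter_image_cyclicClass, mul_inv_cancel_left]

end CyclicRank

/-! ## Differentials of functions on the Grassmannian -/

section Differential

variable {n k : ℕ}

/-- The entries of a matrix, as a linear map to a function space. -/
def entries (n : ℕ) : Matrix (Fin n) (Fin n) ℂ →ₗ[ℂ] (Fin n → Fin n → ℂ) where
  toFun M i j := M i j
  map_add' _ _ := rfl
  map_smul' _ _ := rfl

theorem pullback_entries (f : Gr k n → ℂ) (g : GL (Fin n) ℂ) :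
    pullback f (entries n (g : Matrix (Fin n) (Fin n) ℂ)) = f (g : Gr k n) := by
  have h : IsUnit (Matrix.of (entries n (g : Matrix (Fin n) (Fin n) ℂ))) := g.isUnit
  rw [pullback, dif_pos h]
  congr 2
  exact Units.ext rfl

/-- The differential at `g` of the pullback of `f`. -/
noncomputable def differential (f : Gr k n → ℂ) (g : GL (Fin n) ℂ) :
    Matrix (Fin n) (Fin n) ℂ →ₗ[ℂ] ℂ :=
  (fderiv ℂ (pullback f) (entries n (g : Matrix (Fin n) (Fin n) ℂ))).toLinearMap ∘ₗ entries n

theorem HolAt.differentiableAt {f : Gr k n → ℂ} {g : GL (Fin n) ℂ} (hf : HolAt f (g : Gr k n)) :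
    DifferentiableAt ℂ (pullback f) (entries n (g : Matrix (Fin n) (Fin n) ℂ)) := by
  obtain ⟨U, -, hx, h⟩ := hf
  exact h g hx

section Norms

open scoped Matrix.Norms.Operator

theorem hasDerivAt_entries {γ : ℂ → Matrix (Fin n) (Fin n) ℂ} {γ' : Matrix (Fin n) (Fin n) ℂ}
    {t : ℂ} (h : HasDerivAt γ γ' t) :
    HasDerivAt (fun s => entries n (γ s)) (entries n γ') t :=
  (entries n).toContinuousLinearMap.hasFDerivAt.comp_hasDerivAt t h

theorem HolAt.hasDerivAt_pullback {f : Gr k n → ℂ} {g : GL (Fin n) ℂ}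
    (hf : HolAt f (g : Gr k n)) {γ : ℂ → Matrix (Fin n) (Fin n) ℂ}
    {γ' : Matrix (Fin n) (Fin n) ℂ} (h : HasDerivAt γ γ' 0) (h0 : γ 0 = g) :
    HasDerivAt (fun t => pullback f (entries n (γ t))) (differential f g γ') 0 := by
  have h1 := hf.differentiableAt.hasFDerivAt
  rw [← h0] at h1
  have h2 := h1.comp_hasDerivAt (0 : ℂ) (hasDerivAt_entries h)
  rw [h0] at h2
  exact h2

theorem HolAt.chi_eq {f : Gr k n → ℂ} {g : GL (Fin n) ℂ} (hf : HolAt f (g : Gr k n))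
    (X : Matrix (Fin n) (Fin n) ℂ) :
    chi X f (g : Gr k n) = differential f g (X * (g : Matrix (Fin n) (Fin n) ℂ)) := by
  have h1 : HasDerivAt (fun t : ℂ => NormedSpace.exp (t • X)) X 0 := by
    have := hasDerivAt_exp_smul_const (𝕂 := ℂ) X (0 : ℂ)
    rw [zero_smul, NormedSpace.exp_zero, one_mul] at this
    exact this
  have h2 := hf.hasDerivAt_pullback (h1.mul_const (g : Matrix (Fin n) (Fin n) ℂ)) (by simp)
  have h3 : (fun t : ℂ => f (expGL (t • X) • (g : Gr k n))) = fun t : ℂ => pullback f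
      (entries n (NormedSpace.exp (t • X) * (g : Matrix (Fin n) (Fin n) ℂ))) := by
    funext t
    exact (pullback_entries f (expGL (t • X) * g)).symm
  rw [chi, h3, h2.deriv]

/-- For small t the matrix 1 + tZ lies in P, so the pullback is constant along g(1 + tZ). -/
theorem HolAt.differential_eq_zero {f : Gr k n → ℂ} {g : GL (Fin n) ℂ}
    (hf : HolAt f (g : Gr k n)) {Z : Matrix (Fin n) (Fin n) ℂ}
    (hZ : Matrix.BlockTriangular Z (fun i : Fin n => if (i : ℕ) < k then (0 : ℕ) else 1)) :
    differential f g ((g : Matrix (Fin n) (Fin n) ℂ) * Z) = 0 := by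
  have h1 : HasDerivAt (fun t : ℂ => (g : Matrix (Fin n) (Fin n) ℂ) * (1 + t • Z))
      ((g : Matrix (Fin n) (Fin n) ℂ) * Z) 0 := by
    have := (((hasDerivAt_id (0 : ℂ)).smul_const Z).const_add 1).const_mul
      (g : Matrix (Fin n) (Fin n) ℂ)
    rw [one_smul] at this
    exact this
  have h2 := hf.hasDerivAt_pullback h1 (by simp)
  have hdet : ∀ᶠ t : ℂ in 𝓝 0, (1 + t • Z).det ≠ 0 := by
    have hc : Continuous fun t : ℂ => (1 + t • Z).det := by
      refine Continuous.matrix_det ?_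
      fun_prop
    refine hc.continuousAt.eventually_ne ?_
    simp
  have h3 : (fun t : ℂ => pullback f (entries n ((g : Matrix (Fin n) (Fin n) ℂ) * (1 + t • Z))))
      =ᶠ[𝓝 0] fun _ => f (g : Gr k n) := by
    filter_upwards [hdet] with t ht
    set p : GL (Fin n) ℂ := Matrix.GeneralLinearGroup.mkOfDetNeZero _ ht with hp
    have hpP : p ∈ parabolic k n := by
      show Matrix.BlockTriangular (1 + t • Z) _
      exact Matrix.blockTriangular_one.add fun i j hij => by
        rw [Matrix.smul_apply, hZ hij, smul_zero]
    have h4 := pullback_entries f (g * p)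
    rw [show ((g * p : GL (Fin n) ℂ) : Gr k n) = g by
      rw [QuotientGroup.eq]; simpa using hpP] at h4
    exact h4
  exact (h2.congr_of_eventuallyEq h3.symm).unique (hasDerivAt_const _ _)

end Norms

/-- Matrices supported in the upper right `k × (n - k)` block: the Lie algebra of the unipotent
radical of the parabolic. -/
def nilradical (k n : ℕ) : Submodule ℂ (Matrix (Fin n) (Fin n) ℂ) where
  carrier := {ζ : Matrix (Fin n) (Fin n) ℂ |
    ∀ i j : Fin n, ¬ ((i : ℕ) < k ∧ k ≤ (j : ℕ)) → ζ i j = 0}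
  zero_mem' := fun _ _ _ => rfl
  add_mem' := by
    intro ζ ζ' h h' i j hij
    rw [Matrix.add_apply, h i j hij, h' i j hij, add_zero]
  smul_mem' := by
    intro c ζ h i j hij
    rw [Matrix.smul_apply, h i j hij, smul_zero]

theorem nilradical_mul {ζ ζ' : Matrix (Fin n) (Fin n) ℂ} (h : ζ ∈ nilradical k n)
    (h' : ζ' ∈ nilradical k n) : ζ * ζ' = 0 := by
  ext i j
  rw [Matrix.mul_apply, Matrix.zero_apply]
  refine Finset.sum_eq_zero fun l _ => ?_
  by_cases hl : (l : ℕ) < k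
  · rw [h i l (by omega), zero_mul]
  · rw [h' l j (by omega), mul_zero]

/-- The differential of `f` at `g`, in the left trivialization and under the trace form. -/
noncomputable def gradient (f : Gr k n → ℂ) (g : GL (Fin n) ℂ) : Matrix (Fin n) (Fin n) ℂ :=
  Matrix.of fun i j => differential f g ((g : Matrix (Fin n) (Fin n) ℂ) * Matrix.single j i 1)

theorem differential_mul (f : Gr k n → ℂ) (g : GL (Fin n) ℂ) (Z : Matrix (Fin n) (Fin n) ℂ) :
    differential f g ((g : Matrix (Fin n) (Fin n) ℂ) * Z) = (gradient f g * Z).trace := by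
  conv_lhs => rw [Matrix.matrix_eq_sum_single Z]
  simp only [Matrix.mul_sum, map_sum, Matrix.trace, Matrix.diag, Matrix.mul_apply]
  rw [Finset.sum_comm]
  refine Finset.sum_congr rfl fun i _ => Finset.sum_congr rfl fun j _ => ?_
  rw [gradient, Matrix.of_apply, show Matrix.single j i (Z j i) = Z j i • Matrix.single j i 1 by
    rw [Matrix.smul_single, smul_eq_mul, mul_one], Matrix.mul_smul, map_smul, smul_eq_mul, mul_comm]

/-- The differential kills the parabolic subalgebra, whose annihilator under the trace form is its
nilradical. -/
theorem HolAt.gradient_mem {f : Gr k n → ℂ} {g : GL (Fin n) ℂ} (hf : HolAt f (g : Gr k n)) :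
    gradient f g ∈ nilradical k n := by
  intro i j hij
  refine hf.differential_eq_zero fun a b hab => ?_
  rw [Matrix.single_apply, if_neg]
  rintro ⟨rfl, rfl⟩
  refine hij ?_
  by_cases h1 : (i : ℕ) < k <;> by_cases h2 : (j : ℕ) < k <;> simp [h1, h2] at hab
  omega

/-- Conjugation by an invertible matrix. -/
def conj (g : GL (Fin n) ℂ) : Matrix (Fin n) (Fin n) ℂ →ₗ[ℂ] Matrix (Fin n) (Fin n) ℂ where
  toFun Z := (g : Matrix (Fin n) (Fin n) ℂ) * Z * ((g⁻¹ : GL (Fin n) ℂ) : Matrix (Fin n) (Fin n) ℂ)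
  map_add' Z Z' := by rw [mul_add, add_mul]
  map_smul' c Z := by rw [Matrix.mul_smul, Matrix.smul_mul]; rfl

theorem conj_apply (g : GL (Fin n) ℂ) (Z : Matrix (Fin n) (Fin n) ℂ) :
    conj g Z = (g : Matrix (Fin n) (Fin n) ℂ) * Z *
      ((g⁻¹ : GL (Fin n) ℂ) : Matrix (Fin n) (Fin n) ℂ) := rfl

theorem conj_mul (g h : GL (Fin n) ℂ) (Z : Matrix (Fin n) (Fin n) ℂ) :
    conj (g * h) Z = conj g (conj h Z) := by
  simp only [conj_apply, mul_inv_rev, Units.val_mul, mul_assoc]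

theorem conj_one (Z : Matrix (Fin n) (Fin n) ℂ) : conj 1 Z = Z := by
  simp [conj_apply]

theorem conj_inv_conj (g : GL (Fin n) ℂ) (Z : Matrix (Fin n) (Fin n) ℂ) :
    conj g⁻¹ (conj g Z) = Z := by
  rw [← conj_mul, inv_mul_cancel, conj_one]

theorem conj_conj_inv (g : GL (Fin n) ℂ) (Z : Matrix (Fin n) (Fin n) ℂ) :
    conj g (conj g⁻¹ Z) = Z := by
  rw [← conj_mul, mul_inv_cancel, conj_one]

theorem conj_mul_conj (g : GL (Fin n) ℂ) (Z Z' : Matrix (Fin n) (Fin n) ℂ) :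
    conj g Z * conj g Z' = conj g (Z * Z') := by
  simp only [conj_apply]
  rw [mul_assoc _ _ ((g : Matrix (Fin n) (Fin n) ℂ) * Z' * _),
    mul_assoc (g : Matrix (Fin n) (Fin n) ℂ) Z', ← mul_assoc _ (g : Matrix (Fin n) (Fin n) ℂ),
    ← Units.val_mul g⁻¹ g, inv_mul_cancel, Units.val_one, one_mul]
  simp only [mul_assoc]

theorem trace_conj_mul (g : GL (Fin n) ℂ) (Z X : Matrix (Fin n) (Fin n) ℂ) :
    (conj g Z * X).trace = (Z * conj g⁻¹ X).trace := by
  rw [conj_apply, conj_apply, inv_inv, Matrix.mul_assoc, Matrix.mul_assoc, Matrix.trace_mul_comm]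
  simp only [Matrix.mul_assoc]

theorem differential_mul_right (f : Gr k n → ℂ) (g : GL (Fin n) ℂ)
    (X : Matrix (Fin n) (Fin n) ℂ) :
    differential f g (X * (g : Matrix (Fin n) (Fin n) ℂ)) =
      (conj g (gradient f g) * X).trace := by
  rw [trace_conj_mul, ← differential_mul, conj_apply, inv_inv, ← mul_assoc, ← mul_assoc,
    ← Units.val_mul, mul_inv_cancel, Units.val_one, one_mul]

theorem HolAt.chi_single {f : Gr k n → ℂ} {g : GL (Fin n) ℂ} (hf : HolAt f (g : Gr k n))
    (i j : Fin n) : chi (Matrix.single i j 1) f (g : Gr k n) = conj g (gradient f g) j i := by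
  rw [hf.chi_eq, differential_mul_right, Matrix.trace_mul_single]
  simp

/-- The strictly upper triangular part plus half of the diagonal part. -/
noncomputable def upHalf (n : ℕ) : Matrix (Fin n) (Fin n) ℂ →ₗ[ℂ] Matrix (Fin n) (Fin n) ℂ where
  toFun M := Matrix.of fun i j => (if i < j then 1 else if i = j then 1 / 2 else 0) * M i j
  map_add' M M' := by ext i j; simp [mul_add]
  map_smul' c M := by
    ext i j
    simp only [Matrix.of_apply, Matrix.smul_apply, smul_eq_mul, RingHom.id_apply]
    ring

theorem upHalf_apply (M : Matrix (Fin n) (Fin n) ℂ) (i j : Fin n) :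
    upHalf n M i j = (if i < j then 1 else if i = j then 1 / 2 else 0) * M i j := rfl

/-- The strictly lower triangular part plus half of the diagonal part. -/
noncomputable def loHalf (n : ℕ) : Matrix (Fin n) (Fin n) ℂ →ₗ[ℂ] Matrix (Fin n) (Fin n) ℂ where
  toFun M := Matrix.of fun i j => (if j < i then 1 else if i = j then 1 / 2 else 0) * M i j
  map_add' M M' := by ext i j; simp [mul_add]
  map_smul' c M := by
    ext i j
    simp only [Matrix.of_apply, Matrix.smul_apply, smul_eq_mul, RingHom.id_apply]
    ring

theorem loHalf_apply (M : Matrix (Fin n) (Fin n) ℂ) (i j : Fin n) :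
    loHalf n M i j = (if j < i then 1 else if i = j then 1 / 2 else 0) * M i j := rfl

theorem loHalf_add_upHalf (M : Matrix (Fin n) (Fin n) ℂ) : loHalf n M + upHalf n M = M := by
  ext i j
  rw [Matrix.add_apply, loHalf_apply, upHalf_apply]
  rcases lt_trichotomy i j with h | h | h
  · simp [h, h.not_gt, h.ne]
  · subst h; simp; ring
  · simp [h, h.not_gt, h.ne']

theorem upHalf_upper (M : Matrix (Fin n) (Fin n) ℂ) {i j : Fin n} (h : j < i) :
    upHalf n M i j = 0 := by
  simp [upHalf_apply, h.not_gt, h.ne']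

theorem loHalf_lower (M : Matrix (Fin n) (Fin n) ℂ) {i j : Fin n} (h : i < j) :
    loHalf n M i j = 0 := by
  simp [loHalf_apply, h.not_gt, h.ne]

/-- The bracket of two covectors for the standard Poisson structure. -/
def skewPairing (ξ η : Matrix (Fin n) (Fin n) ℂ) : ℂ :=
  -∑ i : Fin n, ∑ j : Fin n, if i < j then ξ j i * η i j - η j i * ξ i j else 0

theorem HolAt.bracket_eq {F G : Gr k n → ℂ} {g : GL (Fin n) ℂ} (hF : HolAt F (g : Gr k n))
    (hG : HolAt G (g : Gr k n)) :
    bracket F G (g : Gr k n) = skewPairing (conj g (gradient F g)) (conj g (gradient G g)) := by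
  simp only [bracket, skewPairing, hF.chi_single, hG.chi_single]
  congr 1
  refine Finset.sum_congr rfl fun i _ => ?_
  rw [← Finset.sum_filter]
  exact Finset.sum_congr (by ext; simp) fun _ _ => rfl

/-- Subtracting tr(ξη) = 0 doubles the terms with the upper entries of η, cancels those with the
lower entries, and leaves the diagonal terms once: hence the weight 1/2 in `upHalf`. -/
theorem skewPairing_eq {ξ η : Matrix (Fin n) (Fin n) ℂ} (h : (ξ * η).trace = 0) :
    skewPairing ξ η = -2 * (ξ * upHalf n η).trace := by
  have h1 : ∀ A B : Matrix (Fin n) (Fin n) ℂ, (A * B).trace = ∑ i, ∑ j, A j i * B i j := by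
    intro A B
    rw [Matrix.trace_mul_comm, Matrix.trace]
    simp [Matrix.mul_apply, mul_comm]
  have h2 : ∑ i : Fin n, ∑ j : Fin n, (if i < j then η j i * ξ i j else 0) =
      ∑ i : Fin n, ∑ j : Fin n, (if j < i then ξ j i * η i j else 0) := by
    rw [Finset.sum_comm]
    simp only [mul_comm]
  have h3 : skewPairing ξ η = -∑ i : Fin n, ∑ j : Fin n,
      ((if i < j then ξ j i * η i j else 0) - if j < i then ξ j i * η i j else 0) := by
    simp only [Finset.sum_sub_distrib]
    rw [← h2]
    simp only [← Finset.sum_sub_distrib, skewPairing]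
    congr 1
    refine Finset.sum_congr rfl fun i _ => Finset.sum_congr rfl fun j _ => ?_
    split_ifs <;> ring
  have h4 : skewPairing ξ η = -2 * (ξ * upHalf n η).trace + (ξ * η).trace := by
    rw [h3, h1, h1, Finset.mul_sum, ← Finset.sum_neg_distrib, ← Finset.sum_add_distrib]
    refine Finset.sum_congr rfl fun i _ => ?_
    rw [Finset.mul_sum, ← Finset.sum_neg_distrib, ← Finset.sum_add_distrib]
    refine Finset.sum_congr rfl fun j _ => ?_
    rw [upHalf_apply]
    rcases lt_trichotomy i j with h | h | h
    · simp only [h, h.not_gt, if_true, if_false]; ring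
    · subst h; simp only [lt_irrefl, if_true, if_false]; ring
    · simp only [h, h.not_gt, h.ne', if_true, if_false]; ring
  rw [h4, h, add_zero]

theorem trace_conj_mul_conj {ζ ζ' : Matrix (Fin n) (Fin n) ℂ} (h : ζ ∈ nilradical k n)
    (h' : ζ' ∈ nilradical k n) (g : GL (Fin n) ℂ) : (conj g ζ * conj g ζ').trace = 0 := by
  rw [conj_mul_conj, nilradical_mul h h', map_zero, Matrix.trace_zero]

/-- The bracket as the derivative of `F` along the Hamiltonian vector of `G`. -/
theorem HolAt.bracket_eq_differential {F G : Gr k n → ℂ} {g : GL (Fin n) ℂ}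
    (hF : HolAt F (g : Gr k n)) (hG : HolAt G (g : Gr k n)) :
    bracket F G (g : Gr k n) = -2 * differential F g
      (upHalf n (conj g (gradient G g)) * (g : Matrix (Fin n) (Fin n) ℂ)) := by
  rw [hF.bracket_eq hG, skewPairing_eq (trace_conj_mul_conj hF.gradient_mem hG.gradient_mem g),
    differential_mul_right]

theorem bracket_antisymm (F G : Gr k n → ℂ) (x : Gr k n) : bracket F G x = -bracket G F x := by
  simp only [bracket, ← Finset.sum_neg_distrib]
  refine Finset.sum_congr rfl fun i _ => Finset.sum_congr rfl fun j _ => ?_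
  ring

end Differential

/-! ## Hamiltonian curves in the strata -/

section Curves

variable {n k : ℕ}

section Norms

open scoped Matrix.Norms.Operator

/-- Near the identity, a curve of matrices `1 + t η` has a differentiable triangular
factorization. -/
theorem exists_triangular_factorization (η : Matrix (Fin n) (Fin n) ℂ) :
    ∃ M : ℂ → Matrix (Fin n) (Fin n) ℂ, HasDerivAt M η 0 ∧ M 0 = 0 ∧
      ∀ᶠ t in 𝓝 (0 : ℂ), (1 + loHalf n (M t)) * (1 + upHalf n (M t)) = 1 + t • η := by
  set L := (loHalf n).toContinuousLinearMap with hL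
  set U := (upHalf n).toContinuousLinearMap with hU
  set Φ : Matrix (Fin n) (Fin n) ℂ → Matrix (Fin n) (Fin n) ℂ := fun M => (1 + L M) * (1 + U M)
    with hΦ
  have h0 : Φ 0 = 1 := by simp [hΦ]
  -- The derivative at 0 is L + U, the identity because each half carries half of the diagonal, so
  -- the inverse function theorem applies.
  have hd : HasStrictFDerivAt Φ
      ((ContinuousLinearEquiv.refl ℂ (Matrix (Fin n) (Fin n) ℂ) :
        Matrix (Fin n) (Fin n) ℂ ≃L[ℂ] Matrix (Fin n) (Fin n) ℂ) :
        Matrix (Fin n) (Fin n) ℂ →L[ℂ] Matrix (Fin n) (Fin n) ℂ) 0 := by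
    have h1 := (L.hasStrictFDerivAt (x := (0 : Matrix (Fin n) (Fin n) ℂ))).const_add 1
    have h2 := (U.hasStrictFDerivAt (x := (0 : Matrix (Fin n) (Fin n) ℂ))).const_add 1
    refine (h1.mul' h2).congr_fderiv ?_
    refine ContinuousLinearMap.ext fun M => ?_
    change (1 + L 0) * U M + L M * (1 + U 0) = M
    rw [map_zero, map_zero, add_zero, one_mul, mul_one, add_comm]
    exact loHalf_add_upHalf M
  set ψ := hd.localInverse with hψ
  have hψd : HasStrictFDerivAt ψ _ (Φ 0) := hd.to_localInverse
  have hψr : ∀ᶠ y in 𝓝 (Φ 0), Φ (ψ y) = y := hd.eventually_right_inverse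
  have hψ0 : ψ (Φ 0) = 0 := hd.localInverse_apply_image
  rw [h0] at hψd hψr hψ0
  have hc : HasDerivAt (fun t : ℂ => 1 + t • η) η 0 := by
    have := ((hasDerivAt_id (0 : ℂ)).smul_const η).const_add 1
    rw [one_smul] at this
    exact this
  have hc0 : (1 : Matrix (Fin n) (Fin n) ℂ) + (0 : ℂ) • η = 1 := by rw [zero_smul, add_zero]
  refine ⟨fun t => ψ (1 + t • η), ?_, ?_, ?_⟩
  · have h1 := hψd.hasFDerivAt
    rw [← hc0] at h1
    exact h1.comp_hasDerivAt (0 : ℂ) hc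
  · show ψ (1 + (0 : ℂ) • η) = 0
    rw [hc0, hψ0]
  · have h1 := hc.continuousAt.tendsto
    rw [hc0] at h1
    exact h1.eventually hψr

theorem continuousAt_of_coe {b : ℂ → GL (Fin n) ℂ}
    (h : ContinuousAt (fun t => (b t : Matrix (Fin n) (Fin n) ℂ)) 0) : ContinuousAt b 0 :=
  (Units.isOpenEmbedding_val (R := Matrix (Fin n) (Fin n) ℂ)).isInducing.continuousAt_iff.2 h

/-- As ζ² = 0, the matrix p = 1 + tζ has inverse 1 - tζ. Left multiplication of g by 1 + t gζg⁻¹ is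
thus right multiplication by an element of B. -/
theorem one_add_smul_conj {ζ : Matrix (Fin n) (Fin n) ℂ} (hζ : ζ ∈ nilradical k n)
    (g : GL (Fin n) ℂ) (t : ℂ) : ∃ p ∈ borel n,
      ((g * p * g⁻¹ : GL (Fin n) ℂ) : Matrix (Fin n) (Fin n) ℂ) = 1 + t • conj g ζ := by
  have hsq : ζ * ζ = 0 := nilradical_mul hζ hζ
  let p : GL (Fin n) ℂ := ⟨1 + t • ζ, 1 - t • ζ, by
    simp [mul_sub, add_mul, hsq], by simp [sub_mul, mul_add, hsq]⟩
  refine ⟨p, ?_, ?_⟩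
  · show Matrix.BlockTriangular (1 + t • ζ) _
    refine Matrix.blockTriangular_one.add fun i j hij => ?_
    have : (j : ℕ) < i := hij
    rw [Matrix.smul_apply, hζ i j (by omega), smul_zero]
  · show (g : Matrix (Fin n) (Fin n) ℂ) * (1 + t • ζ) * ((g⁻¹ : GL (Fin n) ℂ) : Matrix _ _ ℂ) = _
    rw [mul_add, add_mul, mul_one, ← Units.val_mul, mul_inv_cancel, Units.val_one,
      Matrix.mul_smul, Matrix.smul_mul]
    rfl

/-- Each point of an open Richardson variety moves inside it in Hamiltonian directions. -/
theorem exists_curve {v w : Equiv.Perm (Fin n)} {g : GL (Fin n) ℂ}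
    (hv : InCell (borelOpp n) v g) (hw : InCell (borel n) w g)
    {ζ : Matrix (Fin n) (Fin n) ℂ} (hζ : ζ ∈ nilradical k n) :
    ∃ b : ℂ → GL (Fin n) ℂ, HasDerivAt (fun t => (b t : Matrix (Fin n) (Fin n) ℂ))
      (upHalf n (conj g ζ)) 0 ∧ b 0 = 1 ∧
      ∀ᶠ t in 𝓝 (0 : ℂ), InCell (borelOpp n) v (b t * g) ∧ InCell (borel n) w (b t * g) := by
  classical
  obtain ⟨M, hM, hM0, hfac⟩ := exists_triangular_factorization (conj g ζ)
  have hU : HasDerivAt (fun t => 1 + upHalf n (M t)) (upHalf n (conj g ζ)) 0 :=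
    (((upHalf n).toContinuousLinearMap.hasFDerivAt).comp_hasDerivAt (0 : ℂ) hM).const_add 1
  -- The default value 1 is never used near 0, where the factorization makes the determinant
  -- nonzero.
  set b : ℂ → GL (Fin n) ℂ := fun t =>
    if h : (1 + upHalf n (M t)).det ≠ 0 then Matrix.GeneralLinearGroup.mkOfDetNeZero _ h else 1
    with hb
  have key : ∀ᶠ t in 𝓝 (0 : ℂ), (b t : Matrix (Fin n) (Fin n) ℂ) = 1 + upHalf n (M t) ∧
      InCell (borelOpp n) v (b t * g) ∧ InCell (borel n) w (b t * g) := by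
    filter_upwards [hfac] with t ht
    obtain ⟨p, hp, hpt⟩ := one_add_smul_conj hζ g t
    have hdet : (1 + loHalf n (M t)).det * (1 + upHalf n (M t)).det ≠ 0 := by
      rw [← Matrix.det_mul, ht, ← hpt]
      exact Matrix.GeneralLinearGroup.det_ne_zero _
    have h1 := left_ne_zero_of_mul hdet
    have h2 := right_ne_zero_of_mul hdet
    have hbt : (b t : Matrix (Fin n) (Fin n) ℂ) = 1 + upHalf n (M t) := by
      rw [hb]; simp only [dif_pos h2]; rfl
    set m : GL (Fin n) ℂ := Matrix.GeneralLinearGroup.mkOfDetNeZero _ h1 with hm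
    have hbB : b t ∈ borel n := by
      show Matrix.BlockTriangular (b t : Matrix (Fin n) (Fin n) ℂ) _
      rw [hbt]
      exact Matrix.blockTriangular_one.add fun i j hij => upHalf_upper _ hij
    have hmB : m ∈ borelOpp n := by
      show Matrix.BlockTriangular (1 + loHalf n (M t)) _
      exact Matrix.blockTriangular_one.add fun i j hij => loHalf_lower _ hij
    -- Hence b(t)g = m⁻¹gp: the left side keeps the B-cell of g, the right side its B₋-cell.
    have hmb : m * b t = g * p * g⁻¹ := by
      refine Units.ext ?_
      rw [hpt, ← ht, Units.val_mul, hbt]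
      rfl
    refine ⟨hbt, ?_, hw.mul_left hbB⟩
    have : b t * g = m⁻¹ * (g * p) := by
      rw [show b t = m⁻¹ * (m * b t) by group, hmb]; group
    rw [this]
    exact (hv.mul_right hp).mul_left (inv_mem hmB)
  refine ⟨b, hU.congr_of_eventuallyEq (key.mono fun t ht => ht.1), ?_, key.mono fun t ht => ht.2⟩
  refine Units.ext ?_
  rw [key.self_of_nhds.1, hM0, map_zero, add_zero]
  rfl

/-- Functions which agree on a stratum have the same Hamiltonian derivatives there. -/
theorem differential_congr {v w : Equiv.Perm (Fin n)} {g : GL (Fin n) ℂ}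
    (hv : InCell (borelOpp n) v g) (hw : InCell (borel n) w g)
    {F F' : Gr k n → ℂ} (hF : HolAt F (g : Gr k n)) (hF' : HolAt F' (g : Gr k n))
    (h : ∀ᶠ y in 𝓝 (g : Gr k n), y ∈ lusztigStratum k n v w → F y = F' y)
    {ζ : Matrix (Fin n) (Fin n) ℂ} (hζ : ζ ∈ nilradical k n) :
    differential F g (upHalf n (conj g ζ) * (g : Matrix (Fin n) (Fin n) ℂ)) =
      differential F' g (upHalf n (conj g ζ) * (g : Matrix (Fin n) (Fin n) ℂ)) := by
  obtain ⟨b, hb, hb0, hcell⟩ := exists_curve hv hw hζ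
  have hγ := hb.mul_const (g : Matrix (Fin n) (Fin n) ℂ)
  have hγ0 : (b 0 : Matrix (Fin n) (Fin n) ℂ) * (g : Matrix (Fin n) (Fin n) ℂ) = g := by
    rw [hb0, Units.val_one, one_mul]
  have h1 := hF.hasDerivAt_pullback hγ hγ0
  have h2 := hF'.hasDerivAt_pullback hγ hγ0
  refine h1.unique (h2.congr_of_eventuallyEq ?_)
  have hcont : ContinuousAt (fun t => ((b t * g : GL (Fin n) ℂ) : Gr k n)) 0 :=
    (QuotientGroup.continuous_mk (G := GL (Fin n) ℂ)).continuousAt.comp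
      ((continuousAt_of_coe hb.continuousAt).mul continuousAt_const)
  have htend := hcont.tendsto
  rw [hb0, one_mul] at htend
  filter_upwards [htend.eventually h, hcell] with t ht hc
  have h3 := ht (mem_lusztigStratum.2 ⟨_, rfl, hc⟩)
  exact (pullback_entries F _).trans (h3.trans (pullback_entries F' _).symm)

end Norms

/-- With G fixed, the bracket differentiates F along a curve in the stratum, so F may be changed off
it. Antisymmetry treats G in the same way. -/
theorem isPoissonSubvariety_lusztigStratum (v w : Equiv.Perm (Fin n)) :
    IsPoissonSubvariety (lusztigStratum k n v w) := by
  have key : ∀ (x : lusztigStratum k n v w) (φ : lusztigStratum k n v w → ℂ)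
      (F F' G : Gr k n → ℂ), IsExtensionAt _ φ x F → IsExtensionAt _ φ x F' →
      HolAt G (x : Gr k n) → bracket F G x = bracket F' G x := by
    rintro ⟨x, hx⟩ φ F F' G ⟨hF, hFφ⟩ ⟨hF', hFφ'⟩ hG
    obtain ⟨g, rfl, hv, hw⟩ := mem_lusztigStratum.1 hx
    simp only at hF hF' hG ⊢
    rw [hF.bracket_eq_differential hG, hF'.bracket_eq_differential hG,
      differential_congr hv hw hF hF' ?_ hG.gradient_mem]
    have := hFφ.and hFφ'
    rw [nhds_subtype_eq_comap, Filter.eventually_comap] at this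
    filter_upwards [this] with y hy hyR
    have h := hy ⟨y, hyR⟩ rfl
    exact h.1.trans h.2.symm
  intro x φ ψ F F' G G' hF hF' hG hG'
  rw [key x φ F F' G hF hF' hG.1, bracket_antisymm F' G, key x ψ G G' F' hG hG' hF'.1,
    ← bracket_antisymm]

end Curves

/-! ## Functions with prescribed differential -/

section Realization

variable {n k : ℕ}

/-- The block of a matrix with given rows and columns, as a linear map. -/
def blockMap (p r : Fin n → Prop) :
    Matrix (Fin n) (Fin n) ℂ →ₗ[ℂ] Matrix {i // p i} {j // r j} ℂ where
  toFun M := M.toBlock p r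
  map_add' _ _ := rfl
  map_smul' _ _ := rfl

/-- The index lies in the first block. -/
abbrev InFirst (k : ℕ) {n : ℕ} (i : Fin n) : Prop := (i : ℕ) < k

/-- The linear map `M ↦ ζ₁₂ M₂₁` of block matrices. -/
noncomputable def numerator (k : ℕ) (ζ : Matrix (Fin n) (Fin n) ℂ) : Matrix (Fin n) (Fin n) ℂ →ₗ[ℂ]
    Matrix {i : Fin n // InFirst k i} {i : Fin n // InFirst k i} ℂ where
  toFun M := blockMap (InFirst k) (fun i => ¬ InFirst k i) ζ *
    blockMap (fun i => ¬ InFirst k i) (InFirst k) M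
  map_add' _ _ := by rw [map_add, Matrix.mul_add]
  map_smul' _ _ := by simp only [map_smul, Matrix.mul_smul, RingHom.id_apply]

theorem numerator_apply (ζ M : Matrix (Fin n) (Fin n) ℂ) :
    numerator k ζ M = blockMap (InFirst k) (fun i => ¬ InFirst k i) ζ *
      blockMap (fun i => ¬ InFirst k i) (InFirst k) M := rfl

/-- The function `M ↦ tr (ζ₁₂ M₂₁ M₁₁⁻¹)` of block matrices. -/
noncomputable def chartFun (k : ℕ) (ζ M : Matrix (Fin n) (Fin n) ℂ) : ℂ :=
  (numerator k ζ M * (blockMap (InFirst k) (InFirst k) M)⁻¹).trace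

theorem blockMap_mul_parabolic (r : Fin n → Prop) (M : Matrix (Fin n) (Fin n) ℂ)
    {p : GL (Fin n) ℂ} (hp : p ∈ parabolic k n) :
    blockMap r (InFirst k) (M * (p : Matrix (Fin n) (Fin n) ℂ)) =
      blockMap r (InFirst k) M *
        blockMap (InFirst k) (InFirst k) (p : Matrix (Fin n) (Fin n) ℂ) := by
  have h := Matrix.toBlock_mul_eq_add r (InFirst k) (InFirst k) M (p : Matrix (Fin n) (Fin n) ℂ)
  have h0 : (p : Matrix (Fin n) (Fin n) ℂ).toBlock (fun i => ¬ InFirst k i) (InFirst k) = 0 := by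
    ext ⟨i, hi⟩ ⟨j, hj⟩
    refine hp ?_
    simp only [InFirst] at hi hj
    simp [hi, hj]
  rw [h0, Matrix.mul_zero, add_zero] at h
  exact h

theorem isUnit_det_blockMap {p : GL (Fin n) ℂ} (hp : p ∈ parabolic k n) :
    IsUnit (blockMap (InFirst k) (InFirst k) (p : Matrix (Fin n) (Fin n) ℂ)).det := by
  have h := blockMap_mul_parabolic (InFirst k) ((p⁻¹ : GL (Fin n) ℂ) : Matrix (Fin n) (Fin n) ℂ) hp
  rw [← Units.val_mul, inv_mul_cancel, Units.val_one] at h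
  have h1 : blockMap (InFirst k) (InFirst k) (1 : Matrix (Fin n) (Fin n) ℂ) = 1 :=
    Matrix.toBlock_one_self _
  rw [h1] at h
  exact Matrix.isUnit_det_of_left_inverse h.symm

/-- Right multiplication by p multiplies both M₁₁ and M₂₁ on the right by the invertible block p₁₁,
which cancels in M₂₁M₁₁⁻¹. -/
theorem chartFun_mul_parabolic (ζ M : Matrix (Fin n) (Fin n) ℂ)
    {p : GL (Fin n) ℂ} (hp : p ∈ parabolic k n) :
    chartFun k ζ (M * (p : Matrix (Fin n) (Fin n) ℂ)) = chartFun k ζ M := by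
  have h := isUnit_det_blockMap hp
  have h1 : numerator k ζ (M * (p : Matrix (Fin n) (Fin n) ℂ)) = numerator k ζ M *
      blockMap (InFirst k) (InFirst k) (p : Matrix (Fin n) (Fin n) ℂ) := by
    rw [numerator_apply, blockMap_mul_parabolic _ _ hp, ← Matrix.mul_assoc, ← numerator_apply]
  rw [chartFun, h1, blockMap_mul_parabolic _ _ hp, Matrix.mul_inv_rev,
    Matrix.mul_assoc, Matrix.mul_nonsing_inv_cancel_left _ _ h, chartFun]

open scoped Matrix.Norms.Operator in
theorem differentiableAt_trace_mul_inv {E ι : Type*} [NormedAddCommGroup E] [NormedSpace ℂ E]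
    [Fintype ι] [DecidableEq ι] {D A : E → Matrix ι ι ℂ} {e : E} (hD : DifferentiableAt ℂ D e)
    (hA : DifferentiableAt ℂ A e) (h : (A e).det ≠ 0) :
    DifferentiableAt ℂ (fun x => (D x * (A x)⁻¹).trace) e := by
  obtain ⟨u, hu⟩ := (Matrix.isUnit_iff_isUnit_det (A e)).2 (isUnit_iff_ne_zero.2 h)
  have h1 : DifferentiableAt ℂ (fun x => Ring.inverse (A x)) e := by
    have := differentiableAt_inverse (𝕜 := ℂ) u.isUnit
    rw [hu] at this
    exact this.comp e hA
  have h2 := (Matrix.traceLinearMap ι ℂ ℂ).toContinuousLinearMap.differentiableAt.comp e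
    (hD.mul h1)
  simp only [Matrix.nonsing_inv_eq_ringInverse]
  exact h2

open scoped Matrix.Norms.Operator in
theorem differentiableAt_chartFun (ζ : Matrix (Fin n) (Fin n) ℂ)
    {E : Type*} [NormedAddCommGroup E] [NormedSpace ℂ E] [FiniteDimensional ℂ E]
    (c : Matrix (Fin n) (Fin n) ℂ)
    (ℓ : E →ₗ[ℂ] Matrix (Fin n) (Fin n) ℂ) {e : E}
    (h : (blockMap (InFirst k) (InFirst k) (c + ℓ e)).det ≠ 0) :
    DifferentiableAt ℂ (fun x => chartFun k ζ (c + ℓ x)) e := by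
  have hℓ : DifferentiableAt ℂ (fun x => c + ℓ x) e :=
    (ℓ.toContinuousLinearMap.differentiableAt).const_add c
  exact differentiableAt_trace_mul_inv
    ((numerator k ζ).toContinuousLinearMap.differentiableAt.comp e hℓ)
    ((blockMap (InFirst k) (InFirst k)).toContinuousLinearMap.differentiableAt.comp e hℓ) h

/-- The function on the Grassmannian induced by `chartFun` in the chart centred at `g`. -/
noncomputable def chartFunGr (ζ : Matrix (Fin n) (Fin n) ℂ) (g : GL (Fin n) ℂ) (x : Gr k n) : ℂ :=
  chartFun k ζ ((g⁻¹ * x.out : GL (Fin n) ℂ) : Matrix (Fin n) (Fin n) ℂ)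

theorem chartFunGr_mk (ζ : Matrix (Fin n) (Fin n) ℂ) (g h : GL (Fin n) ℂ) :
    chartFunGr ζ g (h : Gr k n) =
      chartFun k ζ ((g⁻¹ * h : GL (Fin n) ℂ) : Matrix (Fin n) (Fin n) ℂ) := by
  obtain ⟨p, hp⟩ := QuotientGroup.mk_out_eq_mul (parabolic k n) h
  rw [chartFunGr, hp, ← mul_assoc, Units.val_mul, chartFun_mul_parabolic _ _ p.2]

theorem eventually_isUnit (g : GL (Fin n) ℂ) :
    ∀ᶠ E in 𝓝 (entries n (g : Matrix (Fin n) (Fin n) ℂ)), IsUnit (Matrix.of E) := by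
  have hc : Continuous fun E : Fin n → Fin n → ℂ => (Matrix.of E).det :=
    Continuous.matrix_det continuous_id
  have hne : (Matrix.of (entries n (g : Matrix (Fin n) (Fin n) ℂ))).det ≠ 0 :=
    Matrix.GeneralLinearGroup.det_ne_zero g
  filter_upwards [hc.continuousAt.eventually_ne hne] with E hE
  exact (Matrix.isUnit_iff_isUnit_det _).2 (isUnit_iff_ne_zero.2 hE)

theorem holAt_chartFunGr (ζ : Matrix (Fin n) (Fin n) ℂ) (g : GL (Fin n) ℂ) :
    HolAt (chartFunGr ζ g) (g : Gr k n) := by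
  set W : Set (GL (Fin n) ℂ) := {h | (blockMap (InFirst k) (InFirst k)
    ((g⁻¹ * h : GL (Fin n) ℂ) : Matrix (Fin n) (Fin n) ℂ)).det ≠ 0} with hW
  have hWo : IsOpen W := by
    refine isOpen_ne_fun ?_ continuous_const
    refine Continuous.matrix_det ?_
    have h1 : Continuous fun h : GL (Fin n) ℂ =>
        ((g⁻¹ * h : GL (Fin n) ℂ) : Matrix (Fin n) (Fin n) ℂ) :=
      Units.continuous_val.comp (continuous_const.mul continuous_id)
    exact h1.matrix_submatrix _ _
  refine ⟨(QuotientGroup.mk : GL (Fin n) ℂ → Gr k n) '' W, QuotientGroup.isOpenMap_coe W hWo,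
    ⟨g, ?_, rfl⟩, ?_⟩
  · show (blockMap _ _ ((g⁻¹ * g : GL (Fin n) ℂ) : Matrix (Fin n) (Fin n) ℂ)).det ≠ 0
    rw [inv_mul_cancel, Units.val_one,
      show blockMap (InFirst k) (InFirst k) (1 : Matrix (Fin n) (Fin n) ℂ) = 1 from
        Matrix.toBlock_one_self _, Matrix.det_one]
    exact one_ne_zero
  · rintro g' ⟨h, hh, hhg⟩
    rw [QuotientGroup.eq] at hhg
    -- The point g' need not be the representative h found in W, but they differ by P, which changes
    -- this determinant only by a unit.
    have hdet : (blockMap (InFirst k) (InFirst k)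
        ((g⁻¹ * g' : GL (Fin n) ℂ) : Matrix (Fin n) (Fin n) ℂ)).det ≠ 0 := by
      rw [show g⁻¹ * g' = g⁻¹ * h * (h⁻¹ * g') by group, Units.val_mul,
        blockMap_mul_parabolic _ _ hhg, Matrix.det_mul]
      exact mul_ne_zero hh (isUnit_det_blockMap hhg).ne_zero
    set ℓ : (Fin n → Fin n → ℂ) →ₗ[ℂ] Matrix (Fin n) (Fin n) ℂ :=
      { toFun := fun E => ((g⁻¹ : GL (Fin n) ℂ) : Matrix (Fin n) (Fin n) ℂ) * Matrix.of E
        map_add' := fun E E' => Matrix.mul_add _ (Matrix.of E) (Matrix.of E')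
        map_smul' := fun c E => Matrix.mul_smul _ c (Matrix.of E) } with hℓ
    have h1 := differentiableAt_chartFun (k := k) ζ 0 ℓ
      (e := entries n (g' : Matrix (Fin n) (Fin n) ℂ)) (by rw [zero_add]; exact hdet)
    refine h1.congr_of_eventuallyEq ?_
    filter_upwards [eventually_isUnit g'] with E hE
    rw [pullback, dif_pos hE, chartFunGr_mk, zero_add]
    rfl

/-- The numerator vanishes at 1, so a factor t splits off and the derivative at t = 0 is the value
of the other factor there. -/
theorem chartFun_one_add_smul (ζ Z : Matrix (Fin n) (Fin n) ℂ) (t : ℂ) :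
    chartFun k ζ (1 + t • Z) = t * (numerator k ζ Z *
      (blockMap (InFirst k) (InFirst k) (1 + t • Z))⁻¹).trace := by
  have h1 : numerator k ζ 1 = 0 := by
    have h0 : blockMap (fun i => ¬ InFirst k i) (InFirst k) (1 : Matrix (Fin n) (Fin n) ℂ) = 0 :=
      Matrix.toBlock_one_disjoint (isCompl_compl (x := InFirst k (n := n))).disjoint.symm
    rw [numerator_apply, h0, Matrix.mul_zero]
  rw [chartFun, map_add, h1, zero_add, map_smul, Matrix.smul_mul, Matrix.trace_smul, smul_eq_mul]

theorem trace_numerator {ζ : Matrix (Fin n) (Fin n) ℂ} (hζ : ζ ∈ nilradical k n)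
    (Z : Matrix (Fin n) (Fin n) ℂ) : (numerator k ζ Z).trace = (ζ * Z).trace := by
  classical
  have h1 : ∀ i j : Fin n, InFirst k i → InFirst k j → ζ i j = 0 := fun i j _ hj =>
    hζ i j fun h => absurd hj (not_lt.2 h.2)
  have h2 : ∀ i j : Fin n, ¬ InFirst k i → ζ i j = 0 := fun i j hi => hζ i j fun h => hi h.1
  simp only [Matrix.trace, Matrix.diag]
  rw [← Fintype.sum_subtype_add_sum_subtype (InFirst k) fun i => (ζ * Z) i i]
  have h3 : ∑ i : {i : Fin n // ¬ InFirst k i}, (ζ * Z) i i = 0 := by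
    refine Finset.sum_eq_zero fun i _ => ?_
    rw [Matrix.mul_apply]
    exact Finset.sum_eq_zero fun j _ => by rw [h2 _ _ i.2, zero_mul]
  rw [h3, add_zero]
  refine Finset.sum_congr rfl fun i _ => ?_
  have h4 : ∑ j : {j : Fin n // InFirst k j}, ζ i j * Z j i = 0 :=
    Finset.sum_eq_zero fun j _ => by rw [h1 _ _ i.2 j.2, zero_mul]
  rw [Matrix.mul_apply, ← Fintype.sum_subtype_add_sum_subtype (InFirst k) fun j => ζ i j * Z j i,
    h4, zero_add, numerator_apply, Matrix.mul_apply]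
  rfl

open scoped Matrix.Norms.Operator in
/-- Every covector is the differential of a function holomorphic near the point. -/
theorem exists_gradient_eq {ζ : Matrix (Fin n) (Fin n) ℂ} (hζ : ζ ∈ nilradical k n)
    (g : GL (Fin n) ℂ) : ∃ F : Gr k n → ℂ, HolAt F (g : Gr k n) ∧ gradient F g = ζ := by
  refine ⟨chartFunGr ζ g, holAt_chartFunGr ζ g, ?_⟩
  have hF := holAt_chartFunGr (k := k) ζ g
  have key : ∀ Z : Matrix (Fin n) (Fin n) ℂ,
      differential (chartFunGr (k := k) ζ g) g ((g : Matrix (Fin n) (Fin n) ℂ) * Z) =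
        (ζ * Z).trace := by
    intro Z
    have h1 : HasDerivAt (fun t : ℂ => (g : Matrix (Fin n) (Fin n) ℂ) * (1 + t • Z))
        ((g : Matrix (Fin n) (Fin n) ℂ) * Z) 0 := by
      have := (((hasDerivAt_id (0 : ℂ)).smul_const Z).const_add 1).const_mul
        (g : Matrix (Fin n) (Fin n) ℂ)
      rw [one_smul] at this
      exact this
    have h2 := hF.hasDerivAt_pullback h1 (by simp)
    have hone : blockMap (InFirst k) (InFirst k) (1 : Matrix (Fin n) (Fin n) ℂ) = 1 :=
      Matrix.toBlock_one_self _
    have h3 : HasDerivAt (fun t : ℂ => t * (numerator k ζ Z *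
        (blockMap (InFirst k) (InFirst k) (1 + t • Z))⁻¹).trace) (ζ * Z).trace 0 := by
      have hd : DifferentiableAt ℂ (fun t : ℂ => (numerator k ζ Z *
          (blockMap (InFirst k) (InFirst k) (1 + t • Z))⁻¹).trace) 0 := by
        refine differentiableAt_trace_mul_inv (differentiableAt_const _) ?_ ?_
        · exact (blockMap (InFirst k) (InFirst k)).toContinuousLinearMap.differentiableAt.comp
            (0 : ℂ) ((differentiableAt_id.smul_const Z).const_add 1)
        · rw [zero_smul, add_zero, hone, Matrix.det_one]
          exact one_ne_zero
      have := (hasDerivAt_id (0 : ℂ)).mul hd.hasDerivAt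
      rw [id_eq, zero_mul, one_mul, add_zero, zero_smul, add_zero, hone, inv_one, Matrix.mul_one,
        trace_numerator hζ] at this
      exact this
    refine h2.unique (h3.congr_of_eventuallyEq ?_)
    have hcont := (hasDerivAt_entries h1).continuousAt.tendsto
    rw [show (g : Matrix (Fin n) (Fin n) ℂ) * (1 + (0 : ℂ) • Z) = g by simp] at hcont
    filter_upwards [hcont.eventually (eventually_isUnit g)] with t ht
    rw [pullback, dif_pos ht, chartFunGr_mk, ← chartFun_one_add_smul]
    congr 1
    change ((g⁻¹ : GL (Fin n) ℂ) : Matrix (Fin n) (Fin n) ℂ) *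
      ((g : Matrix (Fin n) (Fin n) ℂ) * (1 + t • Z)) = _
    rw [← mul_assoc, ← Units.val_mul, inv_mul_cancel, Units.val_one, one_mul]
  ext i j
  rw [gradient, Matrix.of_apply, key, Matrix.trace_mul_single]
  simp

end Realization

/-! ## The rank of the Poisson structure on a stratum -/

section Rank

variable {n k : ℕ}

theorem blockTriangular_conj {α : Type*} [LinearOrder α] {b : Fin n → α} {h : GL (Fin n) ℂ}
    (hh : h ∈ blockTriangularSubgroup n b) {X : Matrix (Fin n) (Fin n) ℂ}
    (hX : X.BlockTriangular b) : (conj h X).BlockTriangular b :=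
  (Matrix.BlockTriangular.mul hh hX).mul (inv_mem hh)

theorem BlockTriangular.mul_diag {α : Type*} [LinearOrder α] {b : Fin n → α}
    (hb : Function.Injective b) {X Y : Matrix (Fin n) (Fin n) ℂ} (hX : X.BlockTriangular b)
    (hY : Y.BlockTriangular b) (i : Fin n) : (X * Y) i i = X i i * Y i i := by
  rw [Matrix.mul_apply]
  refine Finset.sum_eq_single i (fun j _ hji => ?_) fun h => absurd (Finset.mem_univ _) h
  rcases lt_or_gt_of_ne (hb.ne hji) with h | h
  · rw [hX h, zero_mul]
  · rw [hY h, mul_zero]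

theorem conj_diag {α : Type*} [LinearOrder α] {b : Fin n → α} (hb : Function.Injective b)
    {h : GL (Fin n) ℂ} (hh : h ∈ blockTriangularSubgroup n b) {X : Matrix (Fin n) (Fin n) ℂ}
    (hX : X.BlockTriangular b) (i : Fin n) : conj h X i i = X i i := by
  have h1 := BlockTriangular.mul_diag hb hh (inv_mem hh) i
  rw [← Units.val_mul, mul_inv_cancel, Units.val_one, Matrix.one_apply_eq] at h1
  rw [conj_apply, BlockTriangular.mul_diag hb (Matrix.BlockTriangular.mul hh hX) (inv_mem hh),
    BlockTriangular.mul_diag hb hh hX, mul_right_comm, ← h1, one_mul]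

theorem conj_permGL_apply (v : Equiv.Perm (Fin n)) (X : Matrix (Fin n) (Fin n) ℂ) (i j : Fin n) :
    conj (permGL n v) X (v i) (v j) = X i j := by
  rw [conj_apply, ← map_inv, mul_permGL_apply, permGL_mul_apply]
  congr 1
  exact v.symm_apply_apply j

/-- The projection of a matrix to its upper right `k × (n - k)` block. -/
noncomputable def upperRight (k n : ℕ) : Matrix (Fin n) (Fin n) ℂ →ₗ[ℂ] nilradical k n where
  toFun M := ⟨Matrix.of fun i j => if (i : ℕ) < k ∧ k ≤ (j : ℕ) then M i j else 0,
    fun i j hij => by rw [Matrix.of_apply, if_neg hij]⟩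
  map_add' M M' := by
    ext i j
    by_cases h : (i : ℕ) < k ∧ k ≤ (j : ℕ) <;> simp [h]
  map_smul' c M := by
    ext i j
    by_cases h : (i : ℕ) < k ∧ k ≤ (j : ℕ) <;> simp [h]

theorem upperRight_apply (M : Matrix (Fin n) (Fin n) ℂ) (i j : Fin n) :
    (upperRight k n M : Matrix (Fin n) (Fin n) ℂ) i j =
      if (i : ℕ) < k ∧ k ≤ (j : ℕ) then M i j else 0 := rfl

theorem upperRight_coe (ζ : nilradical k n) : upperRight k n ζ = ζ := by
  ext i j
  rw [upperRight_apply]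
  split_ifs with h
  · rfl
  · exact (ζ.2 i j h).symm

/-- The covectors at `g` with vanishing Hamiltonian vector. -/
def radical (k : ℕ) (g : GL (Fin n) ℂ) : Submodule ℂ (nilradical k n) where
  carrier := {ζ | ∀ i j : Fin n, k ≤ (i : ℕ) → (j : ℕ) < k →
    conj g⁻¹ (upHalf n (conj g ζ)) i j = 0}
  zero_mem' := fun i j _ _ => by simp
  add_mem' := by
    intro ζ ζ' h h' i j hi hj
    rw [Submodule.coe_add, map_add, map_add, map_add, Matrix.add_apply, h i j hi hj, h' i j hi hj,
      add_zero]
  smul_mem' := by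
    intro c ζ h i j hi hj
    rw [Submodule.coe_smul, map_smul, map_smul, map_smul, Matrix.smul_apply, h i j hi hj, smul_zero]

theorem mem_radical {g : GL (Fin n) ℂ} {ζ : nilradical k n} :
    ζ ∈ radical k g ↔ ∀ i j : Fin n, k ≤ (i : ℕ) → (j : ℕ) < k →
      conj g⁻¹ (upHalf n (conj g ζ)) i j = 0 := Iff.rfl

theorem mem_radical_iff_trace {g : GL (Fin n) ℂ} {ζ : nilradical k n} :
    ζ ∈ radical k g ↔ ∀ ζ' ∈ nilradical k n,
      (conj g ζ' * upHalf n (conj g ζ)).trace = 0 := by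
  rw [mem_radical]
  constructor
  · intro h ζ' hζ'
    rw [trace_conj_mul, Matrix.trace]
    refine Finset.sum_eq_zero fun i _ => ?_
    rw [Matrix.diag, Matrix.mul_apply]
    refine Finset.sum_eq_zero fun j _ => ?_
    by_cases hij : (i : ℕ) < k ∧ k ≤ (j : ℕ)
    · rw [h j i hij.2 hij.1, mul_zero]
    · rw [hζ' i j hij, zero_mul]
  · intro h i j hi hj
    have h1 := h (Matrix.single j i 1) fun a b hab => by
      rw [Matrix.single_apply, if_neg]
      rintro ⟨rfl, rfl⟩
      exact hab ⟨hj, hi⟩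
    rw [trace_conj_mul, Matrix.trace_single_mul] at h1
    simpa using h1

/-- Splitting a matrix into upper and lower triangular parts with equal diagonals is unique; this
identifies `upHalf` after transport. -/
theorem upHalf_add_eq {U L : Matrix (Fin n) (Fin n) ℂ} (hU : ∀ i j, j < i → U i j = 0)
    (hL : ∀ i j, i < j → L i j = 0) (hd : ∀ i, U i i = L i i) : upHalf n (U + L) = U := by
  ext i j
  rw [upHalf_apply, Matrix.add_apply]
  rcases lt_trichotomy i j with h | h | h
  · simp [h, hL i j h]
  · subst h
    simp only [lt_irrefl, if_true, if_false, hd]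
    ring
  · simp [h.not_gt, h.ne', hU i j h]

/-- Transport of the radical between two points of a stratum. -/
noncomputable def radicalTransport (k : ℕ) (g γ : GL (Fin n) ℂ) :
    nilradical k n →ₗ[ℂ] nilradical k n where
  toFun ζ := upperRight k n (conj γ⁻¹ (conj g⁻¹ (upHalf n (conj g ζ))) +
    conj g⁻¹ (loHalf n (conj g ζ)))
  map_add' ζ ζ' := by
    simp only [Submodule.coe_add, map_add]
    abel
  map_smul' c ζ := by
    simp only [Submodule.coe_smul, map_smul, map_add, smul_add, RingHom.id_apply]

section Transport

variable {v : Equiv.Perm (Fin n)} {g g' h h' b γ : GL (Fin n) ℂ} {ζ : nilradical k n}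

/-- Conjugation by h⁻¹ keeps the matrix lower triangular, and v⁻¹ moves its support to v i ≥ v j; as
v decreases on blocks, nothing remains below the diagonal inside a block. In the lower left block
both ζ and the other half vanish, the latter because ζ is in the radical. -/
theorem conj_lower (hv : IsMaxRep k v) (hh : h ∈ borelOpp n) (hg : g = h * permGL n v)
    (hζ : ζ ∈ radical k g) :
    (∀ i j, j < i → conj g⁻¹ (loHalf n (conj g ζ)) i j = 0) ∧
    (∀ i j, v i < v j → conj g⁻¹ (loHalf n (conj g ζ)) i j = 0) ∧
    (∀ i, conj g⁻¹ (loHalf n (conj g ζ)) i i = loHalf n (conj g ζ) (v i) (v i)) := by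
  set η := conj g ζ with hη
  have hlow : (loHalf n η).BlockTriangular fun i : Fin n => OrderDual.toDual i :=
    fun i j hij => loHalf_lower _ hij
  have h1 : ∀ i j, conj g⁻¹ (loHalf n η) i j = conj h⁻¹ (loHalf n η) (v i) (v j) := by
    intro i j
    rw [hg, mul_inv_rev, conj_mul,
      ← conj_permGL_apply v (conj (permGL n v)⁻¹ (conj h⁻¹ (loHalf n η))), conj_conj_inv]
  have h2 : ∀ i j, v i < v j → conj g⁻¹ (loHalf n η) i j = 0 := fun i j hij => by
    rw [h1]; exact blockTriangular_conj (inv_mem hh) hlow hij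
  refine ⟨fun i j hij => ?_, h2, fun i => ?_⟩
  · by_cases hb : (j : ℕ) < k ↔ (i : ℕ) < k
    · exact h2 i j (hv.lt hij hb)
    · have hji : (j : ℕ) < i := hij
      have hj : (j : ℕ) < k := by by_contra hj; exact hb (iff_of_false hj (by omega))
      have hi : k ≤ (i : ℕ) := by by_contra hi; exact hb (iff_of_true hj (by omega))
      have h3 : conj g⁻¹ (loHalf n η) + conj g⁻¹ (upHalf n η) = ζ := by
        rw [← map_add, loHalf_add_upHalf, hη, conj_inv_conj]
      have h4 := congrFun (congrFun h3 i) j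
      rw [Matrix.add_apply, mem_radical.1 hζ i j hi hj, add_zero, ζ.2 i j (by omega)] at h4
      exact h4
  · rw [h1, conj_diag (b := fun i : Fin n => OrderDual.toDual i) (fun _ _ h => h) (inv_mem hh) hlow]

/-- Write ζ = u + l for the two halves pulled back by g. Replace u by u' = γ⁻¹uγ and let ζ' be the
upper right block of u' + l. Then g' carries u' to an upper triangular matrix and ζ' - u' to a lower
triangular one with the same diagonal, so the former is the new upper half; pulled back it is u',
which has no lower left block. -/
theorem upHalf_radicalTransport (hv : IsMaxRep k v) (hh : h ∈ borelOpp n)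
    (hh' : h' ∈ borelOpp n) (hb : b ∈ borel n) (hγ : γ ∈ borel n) (hg : g = h * permGL n v)
    (hg' : g' = h' * permGL n v) (hbg : g' = b * g * γ) (hζ : ζ ∈ radical k g) :
    upHalf n (conj g' (radicalTransport k g γ ζ)) = conj b (upHalf n (conj g ζ)) ∧
    radicalTransport k g γ ζ ∈ radical k g' := by
  set η := conj g ζ with hη
  set u := conj g⁻¹ (upHalf n η) with hu
  set l := conj g⁻¹ (loHalf n η) with hl
  obtain ⟨hl1, hl2, hl3⟩ := conj_lower hv hh hg hζ
  rw [← hη, ← hl] at hl1 hl2 hl3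
  have hul : u + l = ζ := by
    rw [← map_add, add_comm, loHalf_add_upHalf, hη, conj_inv_conj]
  have hu1 : u.BlockTriangular fun i : Fin n => i := by
    intro i j hij
    have hij' : (j : ℕ) < i := hij
    have h4 := congrFun (congrFun hul i) j
    rwa [Matrix.add_apply, hl1 i j hij, add_zero, ζ.2 i j (by omega)] at h4
  set u' := conj γ⁻¹ u with hu'
  have hu'1 : u'.BlockTriangular fun i : Fin n => i := blockTriangular_conj (inv_mem hγ) hu1
  have hu'2 : ∀ i, u' i i = u i i := conj_diag (fun _ _ h => h) (inv_mem hγ) hu1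
  have hdiag : ∀ i, u' i i + l i i = 0 := by
    intro i
    have h4 := congrFun (congrFun hul i) i
    rw [hu'2, ← Matrix.add_apply, h4, ζ.2 i i (by omega)]
  set ζ' := radicalTransport k g γ ζ with hζ'
  have hζ'1 : ζ' = upperRight k n (u' + l) := rfl
  have hU : conj g' u' = conj b (upHalf n η) := by
    rw [hu', hu, ← conj_mul, ← conj_mul, hbg, show b * g * γ * γ⁻¹ * g⁻¹ = b by group]
  set L := conj g' (ζ' - u') with hL
  have hsum : conj g' ζ' = conj b (upHalf n η) + L := by
    rw [hL, map_sub, hU]; abel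
  have hupper : (upHalf n η).BlockTriangular fun i : Fin n => i :=
    fun i j hij => upHalf_upper _ hij
  -- In the upper right block the difference is l. Elsewhere it is -u', which is upper triangular,
  -- and i < j in one block contradicts v i < v j.
  have hmid : ∀ i j, v i < v j → (ζ' - u' : Matrix (Fin n) (Fin n) ℂ) i j = 0 := by
    intro i j hij
    rw [Matrix.sub_apply, hζ'1, upperRight_apply]
    split_ifs with hc
    · rw [Matrix.add_apply, hl2 i j hij, add_zero, sub_self]
    · rcases lt_trichotomy i j with hlt | rfl | hlt
      · have hlt' : (i : ℕ) < j := hlt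
        exact absurd hij (not_lt.2 (hv.lt hlt (by omega)).le)
      · exact absurd hij (lt_irrefl _)
      · rw [hu'1 hlt, sub_zero]
  have hmid_diag : ∀ i, (ζ' - u' : Matrix (Fin n) (Fin n) ℂ) i i = l i i := by
    intro i
    rw [Matrix.sub_apply, ζ'.2 i i (by omega), zero_sub, neg_eq_iff_add_eq_zero, hdiag]
  have hmidL : (conj (permGL n v) (ζ' - u')).BlockTriangular
      fun i : Fin n => OrderDual.toDual i := by
    intro i j hij
    obtain ⟨i, rfl⟩ := v.surjective i
    obtain ⟨j, rfl⟩ := v.surjective j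
    rw [conj_permGL_apply]
    exact hmid i j hij
  have hLconj : L = conj h' (conj (permGL n v) (ζ' - u')) := by rw [hL, hg', conj_mul]
  have hL1 : L.BlockTriangular fun i : Fin n => OrderDual.toDual i := by
    rw [hLconj]; exact blockTriangular_conj hh' hmidL
  have hL2 : ∀ i, L i i = loHalf n η i i := by
    intro i
    rw [hLconj,
      conj_diag (b := fun i : Fin n => OrderDual.toDual i) (fun _ _ h => h) hh' hmidL]
    obtain ⟨i, rfl⟩ := v.surjective i
    rw [conj_permGL_apply, hmid_diag, hl3]
  have hmain : upHalf n (conj g' ζ') = conj b (upHalf n η) := by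
    rw [hsum]
    refine upHalf_add_eq (fun i j hij => blockTriangular_conj hb hupper hij)
      (fun i j hij => hL1 hij) fun i => ?_
    rw [hL2, conj_diag (fun _ _ h => h) hb hupper, upHalf_apply, loHalf_apply]
  refine ⟨hmain, mem_radical.2 fun i j hi hj => ?_⟩
  rw [hmain, ← hU, conj_inv_conj]
  refine hu'1 ?_
  show (j : ℕ) < i
  omega

/-- The transport is injective: if ζ maps to 0, then its upper half, conjugated by b, is zero, so ζ
equals its lower half, which the transport leaves unchanged. -/
theorem finrank_radical_le (hv : IsMaxRep k v) (hh : h ∈ borelOpp n)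
    (hh' : h' ∈ borelOpp n) (hb : b ∈ borel n) (hγ : γ ∈ borel n) (hg : g = h * permGL n v)
    (hg' : g' = h' * permGL n v) (hbg : g' = b * g * γ) :
    Module.finrank ℂ (radical k g) ≤ Module.finrank ℂ (radical k g') := by
  have key := fun ζ (hζ : ζ ∈ radical k g) =>
    upHalf_radicalTransport hv hh hh' hb hγ hg hg' hbg hζ
  set T : radical k g →ₗ[ℂ] radical k g' :=
    (radicalTransport k g γ).restrict fun ζ hζ => (key ζ hζ).2 with hT
  refine LinearMap.finrank_le_finrank_of_injective (f := T) fun x y hxy => ?_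
  rw [← sub_eq_zero] at hxy ⊢
  rw [← map_sub T] at hxy
  generalize x - y = z at hxy ⊢
  obtain ⟨ζ, hζ⟩ := z
  have h1 : radicalTransport k g γ ζ = 0 := congrArg Subtype.val hxy
  have h2 := (key ζ hζ).1
  rw [h1, Submodule.coe_zero, map_zero, map_zero] at h2
  have h3 : upHalf n (conj g ζ) = 0 := by
    rw [← conj_inv_conj b (upHalf n (conj g ζ)), ← h2, map_zero]
  have h4 : loHalf n (conj g ζ) = conj g ζ := by
    conv_rhs => rw [← loHalf_add_upHalf (conj g ζ), h3, add_zero]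
  have h5 : radicalTransport k g γ ζ = ζ := by
    show upperRight k n _ = ζ
    rw [h3, h4, map_zero, map_zero, zero_add, conj_inv_conj, upperRight_coe]
  rw [Subtype.ext_iff]
  show ζ = 0
  rw [← h5, h1]

end Transport

/-- Every point of a stratum has a lift in `B₋ v`. -/
theorem exists_lift_borelOpp {v w : Equiv.Perm (Fin n)} {x : Gr k n}
    (hx : x ∈ lusztigStratum k n v w) : ∃ h ∈ borelOpp n,
      ((h * permGL n v : GL (Fin n) ℂ) : Gr k n) = x ∧ InCell (borelOpp n) v (h * permGL n v) ∧
        InCell (borel n) w (h * permGL n v) := by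
  obtain ⟨g, rfl, ⟨h, hh, b, hb, rfl⟩, hw⟩ := mem_lusztigStratum.1 hx
  refine ⟨h, hh, ?_, ⟨h, hh, 1, one_mem _, by group⟩, ?_⟩
  · rw [QuotientGroup.eq, inv_mul_cancel_left]
    exact borel_le_parabolic k n hb
  · have := hw.mul_right (inv_mem hb)
    rwa [mul_inv_cancel_right] at this

theorem finrank_radical_le_of_inCell {v w : Equiv.Perm (Fin n)} (hv : IsMaxRep k v)
    {h h' : GL (Fin n) ℂ} (hh : h ∈ borelOpp n) (hh' : h' ∈ borelOpp n)
    (hw : InCell (borel n) w (h * permGL n v)) (hw' : InCell (borel n) w (h' * permGL n v)) :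
    Module.finrank ℂ (radical k (h * permGL n v)) ≤
      Module.finrank ℂ (radical k (h' * permGL n v)) := by
  obtain ⟨a, ha, b, hb, hab⟩ := hw
  obtain ⟨a', ha', b', hb', hab'⟩ := hw'
  refine finrank_radical_le hv hh hh' (mul_mem ha' (inv_mem ha)) (mul_mem (inv_mem hb) hb')
    rfl rfl ?_
  rw [hab', hab]
  group

/-! ### Rank as the codimension of the radical -/

theorem IsPoissonSubvariety.restrictedBracket_eq {R : Set (Gr k n)} (hR : IsPoissonSubvariety R)
    {φ ψ : R → ℂ} {x : R} {F G : Gr k n → ℂ} (hF : IsExtensionAt R φ x F)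
    (hG : IsExtensionAt R ψ x G) : restrictedBracket R φ ψ x = bracket F G x := by
  have h : HolOnAt R φ x ∧ HolOnAt R ψ x := ⟨⟨F, hF⟩, ⟨G, hG⟩⟩
  rw [restrictedBracket, dif_pos h]
  exact hR x φ ψ _ _ _ _ h.1.choose_spec hF h.2.choose_spec hG

theorem isExtensionAt_restrict {R : Set (Gr k n)} (x : R) {F : Gr k n → ℂ}
    (hF : HolAt F (x : Gr k n)) : IsExtensionAt R (fun y => F y) x F :=
  ⟨hF, Filter.Eventually.of_forall fun _ => rfl⟩

/-- The Hamiltonian derivation defined by a covector. -/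
noncomputable def hamiltonian {R : Set (Gr k n)} (x : R) (g : GL (Fin n) ℂ) :
    nilradical k n →ₗ[ℂ] ({φ : R → ℂ // HolOnAt R φ x} → ℂ) where
  toFun ζ φ := -2 * (conj g (gradient φ.2.choose g) * upHalf n (conj g ζ)).trace
  map_add' ζ ζ' := by
    funext φ
    simp only [Submodule.coe_add, map_add, Matrix.trace_add, Pi.add_apply, mul_add]
  map_smul' c ζ := by
    funext φ
    simp only [Submodule.coe_smul, map_smul, Matrix.mul_smul, Matrix.trace_smul, Pi.smul_apply,
      smul_eq_mul, RingHom.id_apply]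
    ring

theorem hamiltonian_gradient {R : Set (Gr k n)} (hR : IsPoissonSubvariety R) {x : R}
    {g : GL (Fin n) ℂ} (hg : (g : Gr k n) = x) {ψ : R → ℂ} {G : Gr k n → ℂ}
    (hG : IsExtensionAt R ψ x G) (hζ : gradient G g ∈ nilradical k n)
    (φ : {φ : R → ℂ // HolOnAt R φ x}) :
    hamiltonian x g ⟨gradient G g, hζ⟩ φ = restrictedBracket R φ ψ x := by
  have hF := φ.2.choose_spec
  have hF1 := hF.1
  have hG1 := hG.1
  rw [hR.restrictedBracket_eq hF hG]
  rw [← hg] at hF1 hG1 ⊢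
  rw [hF1.bracket_eq_differential hG1, differential_mul_right]
  rfl

/-- Rank-nullity for `hamiltonian`. Every covector is a gradient, so its range is all Hamiltonian
derivations, and there are enough test functions to make its kernel the radical. -/
theorem restrictedRank_add_finrank_radical {R : Set (Gr k n)} (hR : IsPoissonSubvariety R) {x : R}
    {g : GL (Fin n) ℂ} (hg : (g : Gr k n) = x) :
    restrictedRank R x + Module.finrank ℂ (radical k g) = Module.finrank ℂ (nilradical k n) := by
  have hset : {D : {φ : R → ℂ // HolOnAt R φ x} → ℂ |
      ∃ ψ : R → ℂ, HolOnAt R ψ x ∧ ∀ φ, D φ = restrictedBracket R φ ψ x} =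
      (LinearMap.range (hamiltonian x g) : Set ({φ : R → ℂ // HolOnAt R φ x} → ℂ)) := by
    ext D
    constructor
    · rintro ⟨ψ, ⟨G, hG⟩, hD⟩
      have hG1 := hG.1
      rw [← hg] at hG1
      refine ⟨⟨gradient G g, hG1.gradient_mem⟩, funext fun φ => ?_⟩
      rw [hD, hamiltonian_gradient hR hg hG]
    · rintro ⟨⟨ζ, hζ⟩, rfl⟩
      obtain ⟨G, hG, rfl⟩ := exists_gradient_eq hζ g
      rw [hg] at hG
      have hG' := isExtensionAt_restrict x hG
      exact ⟨_, ⟨G, hG'⟩, fun φ => hamiltonian_gradient hR hg hG' hζ φ⟩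
  have hker : LinearMap.ker (hamiltonian x g) = radical k g := by
    ext ζ
    rw [LinearMap.mem_ker, mem_radical_iff_trace]
    obtain ⟨ζ, hζ⟩ := ζ
    obtain ⟨G, hG, rfl⟩ := exists_gradient_eq hζ g
    have hGx := hG
    rw [hg] at hGx
    have hG' := isExtensionAt_restrict x hGx
    constructor
    · intro h ζ' hζ'
      obtain ⟨F, hF, rfl⟩ := exists_gradient_eq hζ' g
      have hFx := hF
      rw [hg] at hFx
      have hF' := isExtensionAt_restrict x hFx
      have h1 := congrFun h ⟨_, ⟨F, hF'⟩⟩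
      rw [hamiltonian_gradient hR hg hG', hR.restrictedBracket_eq hF' hG', ← hg,
        hF.bracket_eq_differential hG, differential_mul_right] at h1
      simpa using h1
    · intro h
      funext φ
      have hF := φ.2.choose_spec.1
      rw [← hg] at hF
      show -2 * _ = (0 : ℂ)
      rw [h _ hF.gradient_mem, mul_zero]
  rw [restrictedRank, hset, Submodule.span_eq, ← hker]
  exact LinearMap.finrank_range_add_finrank_ker _

theorem isRegularPoisson_lusztigStratum {v : Equiv.Perm (Fin n)} (hv : IsMaxRep k v)
    (w : Equiv.Perm (Fin n)) : IsRegularPoisson (lusztigStratum k n v w) := by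
  have hR := isPoissonSubvariety_lusztigStratum (k := k) v w
  refine ⟨hR, fun x y => ?_⟩
  obtain ⟨h, hh, hx, -, hw⟩ := exists_lift_borelOpp x.2
  obtain ⟨h', hh', hy, -, hw'⟩ := exists_lift_borelOpp y.2
  have h1 := restrictedRank_add_finrank_radical hR hx
  have h2 := restrictedRank_add_finrank_radical hR hy
  have h3 := finrank_radical_le_of_inCell hv hh hh' hw hw'
  have h4 := finrank_radical_le_of_inCell hv hh' hh hw' hw
  omega

end Rank

/-! ## Invariance under the Coxeter element -/

section Coxeter

variable {n k : ℕ}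

theorem pullback_smul (a : GL (Fin n) ℂ) (f : Gr k n → ℂ) (E : Fin n → Fin n → ℂ) :
    pullback (fun y => f (a • y)) E =
      pullback f (entries n ((a : Matrix (Fin n) (Fin n) ℂ) * Matrix.of E)) := by
  by_cases h : IsUnit (Matrix.of E)
  · have h' : IsUnit (Matrix.of (entries n ((a : Matrix (Fin n) (Fin n) ℂ) * Matrix.of E))) :=
      a.isUnit.mul h
    rw [pullback, pullback, dif_pos h, dif_pos h']
    refine congrArg f (congrArg (QuotientGroup.mk : GL (Fin n) ℂ → Gr k n) ?_)
    exact Units.ext rfl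
  · have h' : ¬ IsUnit (Matrix.of (entries n ((a : Matrix (Fin n) (Fin n) ℂ) * Matrix.of E))) := by
      intro h'
      refine h ?_
      have := ((a⁻¹ : GL (Fin n) ℂ)).isUnit.mul h'
      change IsUnit (((a⁻¹ : GL (Fin n) ℂ) : Matrix (Fin n) (Fin n) ℂ) *
        ((a : Matrix (Fin n) (Fin n) ℂ) * Matrix.of E)) at this
      rwa [← mul_assoc, ← Units.val_mul, inv_mul_cancel, Units.val_one, one_mul] at this
    rw [pullback, pullback, dif_neg h, dif_neg h']

/-- Left multiplication by an invertible matrix, in terms of matrix entries. -/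
def leftMul (a : GL (Fin n) ℂ) : (Fin n → Fin n → ℂ) →ₗ[ℂ] (Fin n → Fin n → ℂ) where
  toFun E := entries n ((a : Matrix (Fin n) (Fin n) ℂ) * Matrix.of E)
  map_add' E E' := congrArg (entries n) (Matrix.mul_add _ (Matrix.of E) (Matrix.of E'))
  map_smul' c E := congrArg (entries n) (Matrix.mul_smul _ c (Matrix.of E))

theorem hasFDerivAt_pullback_smul {a g : GL (Fin n) ℂ} {f : Gr k n → ℂ}
    (hf : DifferentiableAt ℂ (pullback f) (entries n ((a * g : GL (Fin n) ℂ) : Matrix _ _ ℂ))) :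
    HasFDerivAt (pullback fun y : Gr k n => f (a • y))
      ((fderiv ℂ (pullback f) (entries n ((a * g : GL (Fin n) ℂ) : Matrix _ _ ℂ))).comp
        (leftMul a).toContinuousLinearMap) (entries n (g : Matrix (Fin n) (Fin n) ℂ)) := by
  have h1 : (pullback fun y : Gr k n => f (a • y)) = pullback f ∘ leftMul a :=
    funext fun E => pullback_smul a f E
  rw [h1]
  exact HasFDerivAt.comp (entries n (g : Matrix (Fin n) (Fin n) ℂ)) (g := pullback f)
    hf.hasFDerivAt (leftMul a).toContinuousLinearMap.hasFDerivAt

theorem HolAt.smul {a : GL (Fin n) ℂ} {f : Gr k n → ℂ} {x : Gr k n} (hf : HolAt f (a • x)) :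
    HolAt (fun y => f (a • y)) x := by
  obtain ⟨U, hU, hx, h⟩ := hf
  exact ⟨(fun y => a • y) ⁻¹' U, hU.preimage (continuous_const_smul a), hx,
    fun g hg => (hasFDerivAt_pullback_smul (h (a * g) hg)).differentiableAt⟩

theorem gradient_smul {a g : GL (Fin n) ℂ} {f : Gr k n → ℂ}
    (hf : HolAt f ((a * g : GL (Fin n) ℂ) : Gr k n)) :
    gradient (fun y => f (a • y)) g = gradient f (a * g) := by
  ext i j
  rw [gradient, gradient, Matrix.of_apply, Matrix.of_apply, differential,
    (hasFDerivAt_pullback_smul hf.differentiableAt).fderiv, Units.val_mul, mul_assoc]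
  rfl

/-- Rotation changes the order only between 0, the image of the last index, and the other indices.
The affected terms form row 0 on one side and column 0 on the other, and both sum to zero. -/
theorem sum_lt_finRotate {s : Fin n → Fin n → ℂ} (hs : ∀ i j, s i j = -s j i)
    (h0 : ∀ i, ∑ j, s i j = 0) :
    ∑ i, ∑ j, (if i < j then s (finRotate n i) (finRotate n j) else 0) =
      ∑ i, ∑ j, if i < j then s i j else 0 := by
  cases n with
  | zero => simp
  | succ m =>
    have h00 : s 0 0 = 0 := self_eq_neg.1 (hs 0 0)
    have h1 : ∑ j : Fin m, s 0 j.succ = 0 := by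
      have := h0 0
      rwa [Fin.sum_univ_succ, h00, zero_add] at this
    have h2 : ∑ j : Fin m, s j.succ 0 = 0 := by
      rw [← neg_eq_zero, ← Finset.sum_neg_distrib, ← h1]
      exact Finset.sum_congr rfl fun j _ => (hs 0 j.succ).symm
    have hc : ∀ i : Fin m, finRotate (m + 1) i.castSucc = i.succ := fun i => by
      rw [finRotate_apply]; exact Fin.coeSucc_eq_succ
    have hl : finRotate (m + 1) (Fin.last m) = 0 := finRotate_last
    have hL : ∑ i, ∑ j, (if i < j then s (finRotate (m + 1) i) (finRotate (m + 1) j) else 0) =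
        ∑ i : Fin m, ((∑ j : Fin m, if i < j then s i.succ j.succ else 0) + s i.succ 0) := by
      rw [Fin.sum_univ_castSucc, Finset.sum_eq_zero fun j _ => if_neg (Fin.le_last j).not_gt,
        add_zero]
      refine Finset.sum_congr rfl fun i _ => ?_
      rw [Fin.sum_univ_castSucc, if_pos (Fin.castSucc_lt_last i), hc, hl]
      simp only [hc, Fin.castSucc_lt_castSucc_iff]
    have hR : ∑ i, ∑ j, (if i < j then s i j else 0) = ∑ j : Fin m, s 0 j.succ +
        ∑ i : Fin m, ∑ j : Fin m, if i < j then s i.succ j.succ else 0 := by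
      rw [Fin.sum_univ_succ, Fin.sum_univ_succ, if_neg (lt_irrefl _), zero_add]
      simp only [Fin.succ_pos, if_true]
      congr 1
      refine Finset.sum_congr rfl fun i _ => ?_
      rw [Fin.sum_univ_succ, if_neg (Fin.not_lt_zero _), zero_add]
      simp only [Fin.succ_lt_succ_iff]
    rw [hL, hR, Finset.sum_add_distrib, h1, h2, add_zero, zero_add]

theorem skewPairing_conj_coxeter {ξ η : Matrix (Fin n) (Fin n) ℂ} (h : ξ * η = 0)
    (h' : η * ξ = 0) : skewPairing (conj (coxeter n) ξ) (conj (coxeter n) η) = skewPairing ξ η := by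
  set ξ' := conj (coxeter n) ξ with hξ'
  set η' := conj (coxeter n) η with hη'
  have h1 : ξ' * η' = 0 := by rw [conj_mul_conj, h, map_zero]
  have h2 : η' * ξ' = 0 := by rw [conj_mul_conj, h', map_zero]
  have hξ : ∀ i j, ξ' (finRotate n i) (finRotate n j) = ξ i j := conj_permGL_apply _ ξ
  have hη : ∀ i j, η' (finRotate n i) (finRotate n j) = η i j := conj_permGL_apply _ η
  -- The row sums of this array are the diagonal entries of η'ξ' - ξ'η', and both products vanish.
  have key := sum_lt_finRotate (s := fun i j => ξ' j i * η' i j - η' j i * ξ' i j)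
    (fun i j => by ring) fun i => by
      have e1 := congrFun (congrFun h1 i) i
      have e2 := congrFun (congrFun h2 i) i
      rw [Matrix.mul_apply, Matrix.zero_apply] at e1 e2
      rw [Finset.sum_sub_distrib, sub_eq_zero]
      calc ∑ j, ξ' j i * η' i j = ∑ j, η' i j * ξ' j i :=
            Finset.sum_congr rfl fun _ _ => mul_comm _ _
        _ = ∑ j, ξ' i j * η' j i := e2.trans e1.symm
        _ = ∑ j, η' j i * ξ' i j := Finset.sum_congr rfl fun _ _ => mul_comm _ _
  simp only [hξ, hη] at key
  rw [skewPairing, skewPairing, key]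

/-- The standard Poisson structure is invariant under the Coxeter element. -/
theorem bracket_coxeter {F G : Gr k n → ℂ} {x : Gr k n} (hF : HolAt F (coxeter n • x))
    (hG : HolAt G (coxeter n • x)) :
    bracket (fun y => F (coxeter n • y)) (fun y => G (coxeter n • y)) x =
      bracket F G (coxeter n • x) := by
  induction x using QuotientGroup.induction_on with
  | H g =>
  have hF' : HolAt F ((coxeter n * g : GL (Fin n) ℂ) : Gr k n) := hF
  have hG' : HolAt G ((coxeter n * g : GL (Fin n) ℂ) : Gr k n) := hG
  have h1 : bracket F G (coxeter n • (g : Gr k n)) =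
      bracket F G ((coxeter n * g : GL (Fin n) ℂ) : Gr k n) := rfl
  rw [h1, hF.smul.bracket_eq hG.smul, hF'.bracket_eq hG', gradient_smul hF', gradient_smul hG',
    conj_mul, conj_mul, skewPairing_conj_coxeter]
  · rw [conj_mul_conj, nilradical_mul hF'.gradient_mem hG'.gradient_mem, map_zero]
  · rw [conj_mul_conj, nilradical_mul hG'.gradient_mem hF'.gradient_mem, map_zero]

theorem IsExtensionAt.smul {R₁ R₂ : Set (Gr k n)} {a : GL (Fin n) ℂ} (e : R₁ ≃ₜ R₂)
    (he : ∀ x : R₁, (e x : Gr k n) = a • (x : Gr k n)) {φ : R₂ → ℂ} {x : R₁} {F : Gr k n → ℂ}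
    (hF : IsExtensionAt R₂ φ (e x) F) : IsExtensionAt R₁ (φ ∘ e) x fun y => F (a • y) := by
  refine ⟨HolAt.smul (by rw [← he]; exact hF.1), ?_⟩
  filter_upwards [e.continuous.continuousAt.eventually hF.2] with y hy
  rw [← he, hy]
  rfl

/-- The Coxeter element acts by isomorphisms of Poisson varieties. -/
theorem isPoissonIso_coxeter {R₁ R₂ : Set (Gr k n)} (h₁ : IsPoissonSubvariety R₁)
    (h₂ : IsPoissonSubvariety R₂) (e : R₁ ≃ₜ R₂)
    (he : ∀ x : R₁, (e x : Gr k n) = coxeter n • (x : Gr k n)) : IsPoissonIso e := by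
  refine ⟨fun φ x => ⟨?_, ?_⟩, ?_⟩
  · rintro ⟨F, hF⟩
    have he' : ∀ y : R₂, (e.symm y : Gr k n) = (coxeter n)⁻¹ • (y : Gr k n) := fun y => by
      rw [eq_inv_smul_iff, ← he, e.apply_symm_apply]
    have hF' : IsExtensionAt R₁ (φ ∘ e) (e.symm (e x)) F := by rwa [e.symm_apply_apply]
    have h := IsExtensionAt.smul e.symm he' hF'
    rw [Function.comp_assoc, e.self_comp_symm, Function.comp_id] at h
    exact ⟨_, h⟩
  · rintro ⟨F, hF⟩
    exact ⟨_, hF.smul e he⟩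
  · rintro φ ψ x ⟨F, hF⟩ ⟨G, hG⟩
    rw [h₁.restrictedBracket_eq (hF.smul e he) (hG.smul e he), h₂.restrictedBracket_eq hF hG, he]
    have hF1 := hF.1
    have hG1 := hG.1
    rw [he] at hF1 hG1
    exact bracket_coxeter hF1 hG1

end Coxeter

end LusztigGr

theorem theorem3p1 (n k : ℕ) (hk : k ≤ n) :
    Set.BijOn (fun S : Set (LusztigGr.Gr k n) => (fun x => LusztigGr.coxeter n • x) '' S)
      (LusztigGr.lusztigStrata k n) (LusztigGr.lusztigStrata k n) ∧
    (∀ R ∈ LusztigGr.lusztigStrata k n, LusztigGr.IsRegularPoisson R) ∧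
    (∀ R₁ ∈ LusztigGr.lusztigStrata k n, ∀ R₂ ∈ LusztigGr.lusztigStrata k n,
      (fun x => LusztigGr.coxeter n • x) '' R₁ = R₂ →
      ∃ e : R₁ ≃ₜ R₂,
        (∀ x : R₁, (e x : LusztigGr.Gr k n) = LusztigGr.coxeter n • (x : LusztigGr.Gr k n)) ∧
        LusztigGr.IsPoissonIso e) := by
  have hreg : ∀ R ∈ LusztigGr.lusztigStrata k n, LusztigGr.IsRegularPoisson R := by
    rintro R ⟨v, w, hv, -, rfl⟩
    exact LusztigGr.isRegularPoisson_lusztigStratum hv w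
  refine ⟨LusztigGr.bijOn_coxeter hk, hreg, ?_⟩
  rintro R₁ h₁ R₂ h₂ rfl
  have he : ∀ x : R₁, (((Homeomorph.smul (LusztigGr.coxeter n)).image R₁ x : _) :
      LusztigGr.Gr k n) = LusztigGr.coxeter n • (x : LusztigGr.Gr k n) := fun _ => rfl
  exact ⟨(Homeomorph.smul (LusztigGr.coxeter n)).image R₁, he,
    LusztigGr.isPoissonIso_coxeter (hreg _ h₁).1 (hreg _ h₂).1 _ he⟩
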